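/- Let $\Gamma$ be a group. For a central element $g\in\Gamma$ of infinite order let $e_g\in H^2(\Gamma/\langle g\rangle;\mathbb Q)$ denote the (rational) Euler class of the central extension $1\to\mathbb Z\xrightarrow{\,g\,}\Gamma\to\Gamma/\langle g\rangle\to1$, and let $\rho_g\colon \mathrm B(\Gamma/\langle g\rangle)\to \mathrm B^2\mathbb Z=K(\mathbb Z,2)$ be the map classifying this extension. Suppose that 1. (central Burghelea property) for every central $g\in\Gamma$ of infinite order and every $n\ge 0$ the inverse limit of $$\cdots\xrightarrow{-\cap e_g}H_{n+4}(\Gamma/\langle g\rangle;\mathbb Q)\xrightarrow{-\cap e_g}H_{n+2}(\Gamma/\langle g\rangle;\mathbb Q)\xrightarrow{-\cap e_g}H_{n}(\Gamma/\langle g\rangle;\mathbb Q)$$ vanishes; 2. $\Gamma$ has finite rational cohomological dimension, $\mathrm{cd}_{\mathbb Q}(\Gamma)<\infty$; 3. the rational homology of $\Gamma$ is of finite type, i.e. $\dim_{\mathbb Q}H_n(\Gamma;\mathbb Q)<\infty$ for every $n$. Then $\Gamma$ has the individual kernel property $\mathcal{IKP}$: $\mathrm{cd}_{\mathbb Q}(\Gamma)<\infty$,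 and for every central $g\in\Gamma$ of infinite order the map $\rho_g^*\colon H^*(\mathrm B^2\mathbb Z;\mathbb Q)\to H^*(\mathrm B(\Gamma/\langle g\rangle);\mathbb Q)$ is not injective. Moreover, for every such $g$ the Euler class $e_g$ is nilpotent in the cohomology ring $H^*(\Gamma/\langle g\rangle;\mathbb Q)$. -/

import Mathlib

noncomputable section

open CategoryTheory Opposite
open scoped Simplicial

namespace CentralBurghelea

/-- A normalised inhomogeneous `2`-cocycle of the group `G` with values in `ℤ` (trivial action). -/
structure TwoCocycle (G : Type) [Group G] where
  toFun : G → G → ℤ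
  cocycle : ∀ x y z : G, toFun y z - toFun (x * y) z + toFun x (y * z) - toFun x y = 0
  one_left : ∀ x : G, toFun 1 x = 0
  one_right : ∀ x : G, toFun x 1 = 0

section

variable {G : Type} [Group G] (c : TwoCocycle G)

/-- The alternating sum of the bar faces of `x`, evaluated by `f`. For `f = single` this is the boundary
of the inhomogeneous chain `[x]`, for a cochain `f` it is the coboundary of `f` at `x`. -/
def barD {M : Type} [AddCommGroup M] [Module ℚ M] (n : ℕ) (f : (Fin n → G) → M)
    (x : Fin (n + 1) → G) : M :=
  f (fun i => x i.succ) +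
    ∑ j : Fin (n + 1), (-1 : ℚ) ^ ((j : ℕ) + 1) • f (Fin.contractNth j (· * ·) x)

/-- The value of the cocycle on the last two entries of `x`. -/
def weight {n : ℕ} (x : Fin (n + 2) → G) : ℚ :=
  (c.toFun (x (Fin.last n).castSucc) (x (Fin.last (n + 1))) : ℚ)

/-- All entries of `x` except the last two. -/
def front {n : ℕ} (x : Fin (n + 2) → G) : Fin n → G := fun i => x i.castSucc.castSucc

theorem barD_weight {M : Type} [AddCommGroup M] [Module ℚ M] (n : ℕ) (f : (Fin n → G) → M)
    (x : Fin (n + 3) → G) :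
    barD (n + 2) (fun y => weight c y • f (front y)) x = weight c x • barD n f (front x) := by
  have hf : ∀ j : Fin n, front (Fin.contractNth j.castSucc.castSucc.castSucc (· * ·) x) =
      Fin.contractNth j.castSucc (· * ·) (front x) := by
    intro j
    funext k
    simp [front, Fin.contractNth]
  have hw : ∀ j : Fin n, weight c (Fin.contractNth j.castSucc.castSucc.castSucc (· * ·) x) =
      weight c x := by
    intro j
    have h1 : ¬ (n < (j : ℕ)) := by omega
    have h2 : ¬ (n = (j : ℕ)) := by omega
    have h3 : ¬ (n + 1 < (j : ℕ)) := by omega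
    have h4 : ¬ (n + 1 = (j : ℕ)) := by omega
    simp [weight, Fin.contractNth, h1, h2, h3, h4]
    rfl
  have e1 : front (Fin.contractNth (Fin.last n).castSucc.castSucc (· * ·) x) =
      Fin.contractNth (Fin.last n) (· * ·) (front x) := by
    funext k
    simp [front, Fin.contractNth]
  have e2 : front (Fin.contractNth (Fin.last (n + 1)).castSucc (· * ·) x) =
      Fin.contractNth (Fin.last n) (· * ·) (front x) := by
    funext k
    have : (k : ℕ) < n + 1 := by omega
    simp [front, Fin.contractNth, this]
  have e3 : front (Fin.contractNth (Fin.last (n + 2)) (· * ·) x) =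
      Fin.contractNth (Fin.last n) (· * ·) (front x) := by
    funext k
    have : (k : ℕ) < n + 2 := by omega
    simp [front, Fin.contractNth, this]
  have w0 : weight c (fun i => x i.succ) = weight c x := by
    simp [weight, ← Fin.castSucc_succ]
  have w1 : weight c (Fin.contractNth (Fin.last n).castSucc.castSucc (· * ·) x) =
      c.toFun (x (Fin.last n).castSucc.castSucc * x (Fin.last (n + 1)).castSucc)
        (x (Fin.last (n + 2))) := by
    simp [weight, Fin.contractNth]
    rfl
  have w2 : weight c (Fin.contractNth (Fin.last (n + 1)).castSucc (· * ·) x) =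
      c.toFun (x (Fin.last n).castSucc.castSucc) (x (Fin.last (n + 1)).castSucc *
        (x (Fin.last (n + 2)))) := by
    simp [weight, Fin.contractNth]
  have w3 : weight c (Fin.contractNth (Fin.last (n + 2)) (· * ·) x) =
      c.toFun (x (Fin.last n).castSucc.castSucc) (x (Fin.last (n + 1)).castSucc) := by
    simp [weight, Fin.contractNth]
  have hc : weight c x = c.toFun (x (Fin.last n).castSucc.castSucc *
      x (Fin.last (n + 1)).castSucc) (x (Fin.last (n + 2))) -
      c.toFun (x (Fin.last n).castSucc.castSucc) (x (Fin.last (n + 1)).castSucc *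
        (x (Fin.last (n + 2)))) +
      c.toFun (x (Fin.last n).castSucc.castSucc) (x (Fin.last (n + 1)).castSucc) := by
    have := c.cocycle (x (Fin.last n).castSucc.castSucc) (x (Fin.last (n + 1)).castSucc)
      (x (Fin.last (n + 2)))
    simp only [weight]
    exact_mod_cast (by linarith)
  unfold barD
  rw [Fin.sum_univ_castSucc, Fin.sum_univ_castSucc, Fin.sum_univ_castSucc,
    Fin.sum_univ_castSucc (n := n)]
  simp only [hf, hw, e1, e2, e3, w0, w1, w2, w3, Fin.val_castSucc, Fin.val_last, smul_add,
    Finset.smul_sum]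
  have : front (fun i => x i.succ) = fun i => front x i.succ := rfl
  rw [this, add_assoc, add_assoc]
  congr 2
  · exact Finset.sum_congr rfl fun j _ => smul_comm _ _ _
  · simp only [smul_smul, ← add_smul]
    congr 1
    rw [hc]
    ring


/-- Inhomogeneous (bar) chains of `G` with trivial rational coefficients. -/
abbrev chains (G : Type) [Group G] : ChainComplex (ModuleCat ℚ) ℕ :=
  groupHomology.inhomogeneousChains (Rep.trivial ℚ G ℚ)

/-- Cap product with the cocycle on bar chains:
`[x₁|…|xₙ₊₂] ↦ c(xₙ₊₁, xₙ₊₂) [x₁|…|xₙ]`. -/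
def capChains (n : ℕ) : (chains G).X (n + 2) ⟶ (chains G).X n :=
  ModuleCat.ofHom (Finsupp.lsum ℚ fun x : Fin (n + 2) → G =>
    weight c x • (Finsupp.lsingle (front x) : ℚ →ₗ[ℚ] ((Fin n → G) →₀ ℚ)))

theorem capChains_single (n : ℕ) (x : Fin (n + 2) → G) (a : ℚ) :
    (capChains c n).hom (Finsupp.single x a : (Fin (n + 2) → G) →₀ ℚ) =
      weight c x • (Finsupp.single (front x) a : (Fin n → G) →₀ ℚ) :=
  (Finsupp.lsum_single (S := ℚ) _ x a).trans rfl

theorem boundary_single (n : ℕ) (x : Fin (n + 1) → G) :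
    ((chains G).d (n + 1) n).hom (Finsupp.single x (1 : ℚ) : (Fin (n + 1) → G) →₀ ℚ) =
      barD n (fun y => (Finsupp.single y (1 : ℚ) : (Fin n → G) →₀ ℚ)) x := by
  rw [groupHomology.inhomogeneousChains.d_def]
  exact groupHomology.inhomogeneousChains.d_single (A := Rep.trivial ℚ G ℚ) n x 1

theorem capChains_comp_d (n : ℕ) :
    capChains c (n + 1) ≫ (chains G).d (n + 1) n =
      (chains G).d (n + 3) (n + 2) ≫ capChains c n := by
  apply ModuleCat.hom_ext
  refine Finsupp.lhom_ext' fun x => LinearMap.ext_ring ?_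
  change ((chains G).d (n + 1) n).hom ((capChains c (n + 1)).hom
      (Finsupp.single x (1 : ℚ) : (Fin (n + 3) → G) →₀ ℚ)) =
    (capChains c n).hom (((chains G).d (n + 3) (n + 2)).hom
      (Finsupp.single x (1 : ℚ) : (Fin (n + 3) → G) →₀ ℚ))
  rw [boundary_single, capChains_single]
  refine ((((chains G).d (n + 1) n).hom.map_smul _ _).trans ?_)
  rw [boundary_single, ← barD_weight]
  simp only [barD]
  refine Eq.symm (((capChains c n).hom.map_add _ _).trans ?_)
  rw [capChains_single]
  congr 1
  refine (map_sum (capChains c n).hom _ _).trans (Finset.sum_congr rfl fun j _ => ?_)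
  refine ((capChains c n).hom.map_smul _ _).trans ?_
  rw [capChains_single]

theorem capChains_comp_d_eq_zero (n : ℕ) :
    ((chains G).iCycles (n + 2) ≫ capChains c n) ≫
      (chains G).d n ((ComplexShape.down ℕ).next n) = 0 := by
  cases n with
  | zero => rw [ChainComplex.next_nat_zero, (chains G).shape 0 0 (by simp), Limits.comp_zero]
  | succ n =>
    rw [ChainComplex.next_nat_succ, Category.assoc, capChains_comp_d,
      HomologicalComplex.iCycles_d_assoc, Limits.zero_comp]

/-- Cap product with the cocycle on cycles. -/
def capCycles (n : ℕ) : (chains G).cycles (n + 2) ⟶ (chains G).cycles n :=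
  (chains G).liftCycles ((chains G).iCycles (n + 2) ≫ capChains c n) _ rfl
    (capChains_comp_d_eq_zero c n)

theorem toCycles_capCycles (n : ℕ) :
    (chains G).toCycles (n + 3) (n + 2) ≫ capCycles c n ≫ (chains G).homologyπ n = 0 := by
  have h : (chains G).toCycles (n + 3) (n + 2) ≫ capCycles c n =
      capChains c (n + 1) ≫ (chains G).toCycles (n + 1) n := by
    rw [← cancel_mono ((chains G).iCycles n)]
    simp only [capCycles, Category.assoc, HomologicalComplex.liftCycles_i,
      HomologicalComplex.toCycles_i, HomologicalComplex.toCycles_i_assoc]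
    exact (capChains_comp_d c n).symm
  rw [← Category.assoc, h, Category.assoc, HomologicalComplex.toCycles_comp_homologyπ,
    Limits.comp_zero]

/-- Cap product `H_{n+2}(G; ℚ) ⟶ H_n(G; ℚ)` with the class of the cocycle. -/
def capHomology (n : ℕ) :
    groupHomology (Rep.trivial ℚ G ℚ) (n + 2) ⟶ groupHomology (Rep.trivial ℚ G ℚ) n :=
  ((chains G).homologyIsCokernel (n + 3) (n + 2) (ChainComplex.prev ℕ (n + 2))).desc
    (Limits.CokernelCofork.ofπ (capCycles c n ≫ (chains G).homologyπ n)
      (toCycles_capCycles c n))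

theorem π_capHomology (n : ℕ) :
    groupHomology.π (Rep.trivial ℚ G ℚ) (n + 2) ≫ capHomology c n =
      capCycles c n ≫ groupHomology.π (Rep.trivial ℚ G ℚ) n :=
  Limits.Cofork.IsColimit.π_desc
    ((chains G).homologyIsCokernel (n + 3) (n + 2) (ChainComplex.prev ℕ (n + 2)))

/-- The cup product of inhomogeneous cochains with trivial rational coefficients. -/
def cup {p q : ℕ} (f : (Fin p → G) → ℚ) (h : (Fin q → G) → ℚ) : (Fin (p + q) → G) → ℚ :=
  fun x => f (fun i => x (Fin.castAdd q i)) * h (fun i => x (Fin.natAdd p i))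

/-- The rational bar cochain underlying an integral `2`-cocycle. -/
def TwoCocycle.toCochain : (Fin 2 → G) → ℚ := fun x => (c.toFun (x 0) (x 1) : ℚ)

/-- The `m`-fold cup product of the cocycle with itself, a cochain of degree `2 * m`. -/
def cupPower (m : ℕ) : (Fin (2 * m) → G) → ℚ :=
  Nat.rec (motive := fun m => (Fin (2 * m) → G) → ℚ) (fun _ => 1)
    (fun _ f => cup f c.toCochain) m

theorem d_cupPower (m : ℕ) :
    inhomogeneousCochains.d (Rep.trivial ℚ G ℚ) (2 * m) (cupPower c m) = 0 := by
  induction m with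
  | zero =>
    funext x
    change barD 0 (fun _ => (1 : ℚ)) x = 0
    simp [barD]
  | succ m ih =>
    funext x
    have h := barD_weight c (2 * m) (cupPower c m) x
    have h0 : barD (2 * m) (cupPower c m) (front x) = 0 := congrFun ih (front x)
    rw [h0, smul_zero] at h
    rw [Pi.zero_apply, ← h]
    change barD (2 * m + 2) (fun y => cupPower c m (front y) * weight c y) x = _
    simp only [smul_eq_mul, mul_comm]

/-- The `m`-th power, in the cohomology ring of `G` with rational coefficients, of the class
of the cocycle. -/
def cohomologyPower (m : ℕ) : groupCohomology (Rep.trivial ℚ G ℚ) (2 * m) :=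
  groupCohomology.π (Rep.trivial ℚ G ℚ) (2 * m)
    (groupCohomology.cocyclesMk (cupPower c m) (d_cupPower c m))

end

/-- The Eilenberg-MacLane space `K(ℤ, 2) = B²ℤ`, in its standard simplicial model: its `n`-simplices
are the normalised simplicial `2`-cocycles on the standard `n`-simplex with values in `ℤ`. -/
def deloopingTwo : SSet.{0} where
  obj n := { z : (⦋2⦌ ⟶ n.unop) → ℤ //
    (∀ τ : ⦋3⦌ ⟶ n.unop, ∑ i : Fin 4, (-1 : ℤ) ^ (i : ℕ) * z (SimplexCategory.δ i ≫ τ) = 0) ∧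
    (∀ (ε : ⦋1⦌ ⟶ n.unop) (i : Fin 2), z (SimplexCategory.σ i ≫ ε) = 0) }
  map f := ↾fun z => ⟨fun τ => z.1 (τ ≫ f.unop),
    fun τ => by simpa only [Category.assoc] using z.2.1 (τ ≫ f.unop),
    fun ε i => by simpa only [Category.assoc] using z.2.2 (ε ≫ f.unop) i⟩

/-- The cosimplicial vector space `n ↦ Map(Xₙ, ℚ)` of a simplicial set `X`. -/
def cosimplicialCochains (X : SSet.{0}) : CosimplicialObject (ModuleCat.{0} ℚ) where
  obj n := ModuleCat.of ℚ (X.obj (op n) → ℚ)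
  map f := ModuleCat.ofHom (LinearMap.funLeft ℚ ℚ (X.map f.op))

/-- The rational simplicial cochain complex of a simplicial set, with differential the alternating
sum of the coface maps. Its homology in degree `n` is `Hⁿ(X; ℚ)`. -/
def simplicialCochains (X : SSet.{0}) : CochainComplex (ModuleCat.{0} ℚ) ℕ :=
  (AlgebraicTopology.alternatingCofaceMapComplex (ModuleCat.{0} ℚ)).obj (cosimplicialCochains X)

section
variable {G : Type} [Group G] (c : TwoCocycle G)

/-- The label of the edge from the `i`-th to the `j`-th vertex of the simplex `[x₁|…|xₙ]` of `BG`,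
that is `xᵢ₊₁ ⋯ xⱼ` when `i ≤ j`. -/
def edge {n : ℕ} (x : Fin n → G) (i j : Fin (n + 1)) : G :=
  (Fin.partialProd x i)⁻¹ * Fin.partialProd x j

theorem edge_self {n : ℕ} (x : Fin n → G) (i : Fin (n + 1)) : edge x i i = 1 :=
  inv_mul_cancel _

theorem edge_mul_edge {n : ℕ} (x : Fin n → G) (i j k : Fin (n + 1)) :
    edge x i j * edge x j k = edge x i k := by
  simp [edge, mul_assoc]

/-- The map `BG ⟶ K(ℤ, 2)` that classifies the cocycle, on the simplex `[x₁|…|xₙ]` of the bar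
construction: a triangle of it is sent to the value of the cocycle on its first and last edge. -/
def classifyingSimplex {n : ℕ} (x : Fin n → G) : deloopingTwo _⦋n⦌ :=
  ⟨fun τ : ⦋2⦌ ⟶ ⦋n⦌ =>
    c.toFun (edge x (τ.toOrderHom 0) (τ.toOrderHom 1)) (edge x (τ.toOrderHom 1) (τ.toOrderHom 2)),
    fun τ : ⦋3⦌ ⟶ ⦋n⦌ => by
      have h := c.cocycle (edge x (τ.toOrderHom 0) (τ.toOrderHom 1))
        (edge x (τ.toOrderHom 1) (τ.toOrderHom 2)) (edge x (τ.toOrderHom 2) (τ.toOrderHom 3))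
      rw [edge_mul_edge, edge_mul_edge] at h
      rw [Fin.sum_univ_four, ← h]
      change (-1 : ℤ) ^ 0 * c.toFun (edge x (τ.toOrderHom 1) (τ.toOrderHom 2))
          (edge x (τ.toOrderHom 2) (τ.toOrderHom 3)) +
        (-1 : ℤ) ^ 1 * c.toFun (edge x (τ.toOrderHom 0) (τ.toOrderHom 2))
          (edge x (τ.toOrderHom 2) (τ.toOrderHom 3)) +
        (-1 : ℤ) ^ 2 * c.toFun (edge x (τ.toOrderHom 0) (τ.toOrderHom 1))
          (edge x (τ.toOrderHom 1) (τ.toOrderHom 3)) +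
        (-1 : ℤ) ^ 3 * c.toFun (edge x (τ.toOrderHom 0) (τ.toOrderHom 1))
          (edge x (τ.toOrderHom 1) (τ.toOrderHom 2)) = _
      ring,
    fun (ε : ⦋1⦌ ⟶ ⦋n⦌) i => by
      fin_cases i
      · change c.toFun (edge x (ε.toOrderHom 0) (ε.toOrderHom 0)) _ = 0
        rw [edge_self, c.one_left]
      · change c.toFun _ (edge x (ε.toOrderHom 1) (ε.toOrderHom 1)) = 0
        rw [edge_self, c.one_right]⟩

theorem edge_tail {n : ℕ} (x : Fin (n + 1) → G) (i j : Fin (n + 1)) :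
    edge x i.succ j.succ = edge (fun k => x k.succ) i j := by
  simp only [edge, Fin.partialProd_succ', mul_inv_rev, mul_assoc, inv_mul_cancel_left]
  rfl

theorem edge_contractNth {n : ℕ} (x : Fin (n + 1) → G) (a : Fin (n + 1)) (i j : Fin (n + 1)) :
    edge x (a.succ.succAbove i) (a.succ.succAbove j) =
      edge (Fin.contractNth a (· * ·) x) i j := by
  simp only [edge, Fin.partialProd_contractNth, Function.comp]

theorem δ_zero_classifyingSimplex {n : ℕ} (x : Fin (n + 1) → G) :
    deloopingTwo.δ 0 (classifyingSimplex c x) = classifyingSimplex c (fun i => x i.succ) := by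
  apply Subtype.ext
  funext τ
  change c.toFun (edge x (Fin.succAbove 0 _) (Fin.succAbove 0 _))
    (edge x (Fin.succAbove 0 _) (Fin.succAbove 0 _)) = _
  simp only [Fin.zero_succAbove, edge_tail]
  rfl

theorem δ_succ_classifyingSimplex {n : ℕ} (x : Fin (n + 1) → G) (j : Fin (n + 1)) :
    deloopingTwo.δ j.succ (classifyingSimplex c x) =
      classifyingSimplex c (Fin.contractNth j (· * ·) x) := by
  apply Subtype.ext
  funext τ
  change c.toFun (edge x (j.succ.succAbove _) (j.succ.succAbove _))
    (edge x (j.succ.succAbove _) (j.succ.succAbove _)) = _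
  simp only [edge_contractNth]
  rfl

theorem alternating_sum_apply {V W : ModuleCat.{0} ℚ} {n : ℕ} (F : Fin n → (V ⟶ W)) (v : V) :
    (∑ i : Fin n, (-1 : ℤ) ^ (i : ℕ) • F i).hom v =
      ∑ i : Fin n, (-1 : ℚ) ^ (i : ℕ) • (F i).hom v := by
  rw [ModuleCat.hom_sum, LinearMap.sum_apply]
  refine Finset.sum_congr rfl fun i _ => ?_
  rw [ModuleCat.hom_zsmul, LinearMap.smul_apply, ← Int.cast_smul_eq_zsmul ℚ]
  simp

theorem simplicialCochains_d_apply (X : SSet.{0}) (n : ℕ) (f : X _⦋n⦌ → ℚ) (y : X _⦋n + 1⦌) :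
    (show X _⦋n + 1⦌ → ℚ from ((simplicialCochains X).d n (n + 1)).hom f) y =
      ∑ i : Fin (n + 2), (-1 : ℚ) ^ (i : ℕ) * f (X.δ i y) := by
  have h : (simplicialCochains X).d n (n + 1) =
      AlgebraicTopology.AlternatingCofaceMapComplex.objD (cosimplicialCochains X) n :=
    CochainComplex.of_d (fun n => (cosimplicialCochains X).obj ⦋n⦌)
      (AlgebraicTopology.AlternatingCofaceMapComplex.objD (cosimplicialCochains X)) n
  rw [h]
  refine (congrFun (alternating_sum_apply (fun i => (cosimplicialCochains X).δ i) f) y).trans ?_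
  exact Finset.sum_apply y _ _

/-- Pullback of cochains along the classifying map `BG ⟶ K(ℤ, 2)`; the cochains of `BG` are the
inhomogeneous cochains of `G`. -/
def classifyingCochains :
    simplicialCochains deloopingTwo ⟶
      groupCohomology.inhomogeneousCochains (Rep.trivial ℚ G ℚ) where
  f n := ModuleCat.ofHom (LinearMap.funLeft ℚ ℚ (classifyingSimplex c (n := n)))
  comm' i j hij := by
    obtain rfl : i + 1 = j := hij
    rw [groupCohomology.inhomogeneousCochains.d_def]
    apply ModuleCat.hom_ext
    refine LinearMap.ext fun (f : deloopingTwo _⦋i⦌ → ℚ) => funext fun x => ?_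
    change barD i (fun y => f (classifyingSimplex c y)) x =
      (show deloopingTwo _⦋i + 1⦌ → ℚ from
        ((simplicialCochains deloopingTwo).d i (i + 1)).hom f) (classifyingSimplex c x)
    rw [simplicialCochains_d_apply, Fin.sum_univ_succ]
    simp only [δ_zero_classifyingSimplex, δ_succ_classifyingSimplex, barD, Fin.val_zero, pow_zero,
      one_mul, Fin.val_succ, smul_eq_mul]

/-- The map `Hⁿ(B²ℤ; ℚ) ⟶ Hⁿ(BG; ℚ) = Hⁿ(G; ℚ)` induced by the classifying map of the cocycle. -/
def classifyingMap (n : ℕ) :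
    (simplicialCochains deloopingTwo).homology n ⟶ groupCohomology (Rep.trivial ℚ G ℚ) n :=
  HomologicalComplex.homologyMap (classifyingCochains c) n

end

/-- A central element of infinite order. -/
structure CentralElement (Γ : Type) [Group Γ] where
  val : Γ
  mem_center : val ∈ Subgroup.center Γ
  infinite_order : ¬ IsOfFinOrder val

section
variable {Γ : Type} [Group Γ] (g : CentralElement Γ)

theorem CentralElement.comm (x : Γ) (k : ℤ) : x * g.val ^ k = g.val ^ k * x :=
  (Commute.zpow_right (Subgroup.mem_center_iff.1 g.mem_center x) k)

instance CentralElement.normal : (Subgroup.zpowers g.val).Normal where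
  conj_mem := by
    rintro _ ⟨k, rfl⟩ x
    exact ⟨k, by simp only [g.comm, mul_inv_cancel_right]⟩

/-- The quotient `Γ/⟨g⟩`. -/
abbrev CentralElement.BaseGroup : Type := Γ ⧸ Subgroup.zpowers g.val

open Classical in
/-- A set-theoretic right inverse of `Γ → Γ/⟨g⟩` with `1 ↦ 1`. -/
def CentralElement.lift (q : g.BaseGroup) : Γ := if q = 1 then 1 else q.out

theorem CentralElement.mk_lift (q : g.BaseGroup) : (g.lift q : g.BaseGroup) = q := by
  unfold CentralElement.lift
  split_ifs with h
  · exact h.symm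
  · exact Quotient.out_eq' q

theorem CentralElement.exists_zpow (p q : g.BaseGroup) :
    ∃ k : ℤ, g.lift p * g.lift q = g.val ^ k * g.lift (p * q) := by
  have h : ((g.lift (p * q) : Γ) : g.BaseGroup) = ((g.lift p * g.lift q : Γ) : g.BaseGroup) := by
    rw [QuotientGroup.mk_mul, g.mk_lift, g.mk_lift, g.mk_lift]
  obtain ⟨k, hk⟩ := QuotientGroup.eq.1 h
  refine ⟨k, ?_⟩
  rw [← g.comm]
  exact (eq_mul_of_inv_mul_eq hk.symm)

/-- The integer `k` with `s(p) s(q) = g ^ k s(p q)`, where `s` is the chosen lift. -/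
def CentralElement.eulerFun (p q : g.BaseGroup) : ℤ := Classical.choose (g.exists_zpow p q)

theorem CentralElement.eulerFun_spec (p q : g.BaseGroup) :
    g.lift p * g.lift q = g.val ^ g.eulerFun p q * g.lift (p * q) :=
  Classical.choose_spec (g.exists_zpow p q)

theorem CentralElement.zpow_injective : Function.Injective fun k : ℤ => g.val ^ k :=
  injective_zpow_iff_not_isOfFinOrder.2 g.infinite_order

/-- The cocycle of the central extension `1 → ℤ → Γ → Γ/⟨g⟩ → 1` given by `g`; its class in
`H²(Γ/⟨g⟩; ℚ)` is the Euler class of the extension. -/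
def CentralElement.eulerCocycle : TwoCocycle g.BaseGroup where
  toFun := g.eulerFun
  cocycle x y z := by
    have h : g.val ^ (g.eulerFun x y + g.eulerFun (x * y) z) =
        g.val ^ (g.eulerFun y z + g.eulerFun x (y * z)) := by
      apply mul_right_cancel (b := g.lift (x * y * z))
      calc g.val ^ (g.eulerFun x y + g.eulerFun (x * y) z) * g.lift (x * y * z)
          = g.lift x * g.lift y * g.lift z := by
            rw [g.eulerFun_spec x y, mul_assoc (g.val ^ _) (g.lift _), g.eulerFun_spec (x * y) z,
              zpow_add, mul_assoc (g.val ^ _) (g.val ^ _)]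
        _ = g.val ^ (g.eulerFun y z + g.eulerFun x (y * z)) * g.lift (x * y * z) := by
            rw [mul_assoc, g.eulerFun_spec y z, ← mul_assoc, g.comm, mul_assoc,
              g.eulerFun_spec x (y * z), zpow_add, mul_assoc (g.val ^ _) (g.val ^ _), mul_assoc x y z]
    have := g.zpow_injective h
    omega
  one_left x := by
    apply g.zpow_injective
    have h := g.eulerFun_spec 1 x
    have h1 : g.lift 1 = 1 := if_pos rfl
    rw [h1, one_mul, one_mul] at h
    simpa using h.symm
  one_right x := by
    apply g.zpow_injective
    have h := g.eulerFun_spec x 1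
    have h1 : g.lift 1 = 1 := if_pos rfl
    rw [h1, mul_one, mul_one] at h
    simpa using h.symm

/-- The inverse limit of `… → H_{n+4}(Γ/⟨g⟩; ℚ) → H_{n+2}(Γ/⟨g⟩; ℚ) → H_n(Γ/⟨g⟩; ℚ)` along cap products
with the Euler class. As `g` is central, its centraliser is `Γ`. -/
def CentralElement.capLimit (n : ℕ) :
    Submodule ℚ (∀ k : ℕ, groupHomology (Rep.trivial ℚ g.BaseGroup ℚ) (n + 2 * k)) where
  carrier := { z | ∀ k : ℕ, (capHomology g.eulerCocycle (n + 2 * k)).hom (z (k + 1)) = z k }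
  add_mem' := fun {a b} ha hb k => by
    exact (map_add _ _ _).trans (congrArg₂ _ (ha k) (hb k))
  zero_mem' := fun k => map_zero _
  smul_mem' := fun r z hz k => ((map_smul _ r _).trans (congrArg _ (hz k)))

end

/-- Finite rational cohomological dimension. -/
def HasFiniteRationalCD (Γ : Type) [Group Γ] : Prop :=
  ∃ d : ℕ, ∀ (A : Rep.{0} ℚ Γ) (n : ℕ), d < n → Limits.IsZero (groupCohomology A n)

/-- Every rational homology group of `Γ` is finite-dimensional. -/
def HasFiniteTypeRationalHomology (Γ : Type) [Group Γ] : Prop :=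
  ∀ n : ℕ, Module.Finite ℚ (groupHomology (Rep.trivial ℚ Γ ℚ) n)

/-- The central Burghelea property. -/
def CBP (Γ : Type) [Group Γ] : Prop :=
  ∀ (g : CentralElement Γ) (n : ℕ), g.capLimit n = ⊥

/-- The individual kernel property: finite rational cohomological dimension, and for each central `g`
of infinite order the map `H^*(B²ℤ; ℚ) ⟶ H^*(B(Γ/⟨g⟩); ℚ)` that is induced by the classifying map of
the extension is not injective (a graded map: not injective in some degree). -/
def IKP (Γ : Type) [Group Γ] : Prop :=
  HasFiniteRationalCD Γ ∧ ∀ g : CentralElement Γ, ∃ n : ℕ,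
    ¬ Function.Injective (classifyingMap g.eulerCocycle n)

end CentralBurghelea

end

noncomputable section

open CategoryTheory

namespace CentralBurghelea

/-! ### The bar coboundary and its twist by a set-theoretic lift -/

section Bar

variable {G : Type} [Group G] {M : Type} [AddCommGroup M] [Module ℚ M]

/-! Write G = Γ/⟨g⟩ and e for the Euler class. The extension by ℤ has a Gysin sequence, in which
H^{n+1}(Γ) sits before the map H^n(G) → H^{n+2}(G) given by the cup product with e. Above the
rational cohomological dimension of Γ this map is injective, so by duality over the field ℚ the cap
product H_{n+2}(G) → H_n(G) is surjective. Along a tower of surjections the inverse limit maps onto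
its bottom term, and by the central Burghelea property the limit is zero; hence H_n(G) = 0 for large
n. By duality H^n(G) = 0 as well, and a high power of e vanishes.

The needed piece of the Gysin sequence comes from an explicit free resolution of ℚ over ℚ[Γ]. Bar
chains of G with coefficients in ℚ[Γ], twisted by a lift s : G → Γ, have a boundary ∂ with ∂² = (g -
1)h, because s is multiplicative only up to powers of g. Pairing ∂ with the two-term resolution of
⟨g⟩ and correcting by h gives an honest complex; it is exact because g - 1 is injective and the
chains modulo g - 1 form the contractible bar complex of G. On invariant functionals h becomes -e,
and `CentralElement.exists_primitive` reads off the injectivity. `capHomology_surjective` dualises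
it and `exists_cohomologyPower_eq_zero` concludes nilpotence.

For the kernel property, the classifying map sends the power u^m of the fundamental class u of K(ℤ,
2) to e^m (`classifyingMap_universalClass`), so it remains to see u^m ≠ 0 for positive m. Pulled
back to the group ℤ^{2m} along a cocycle of symplectic type, u^m is nonzero on the antisymmetrised
top simplex of the torus, where all coboundaries vanish. -/

theorem barD_barD (n : ℕ) (f : (Fin n → G) → M) : barD (n + 1) (barD n f) = 0 := by
  have h := groupCohomology.inhomogeneousCochains.d_comp_d n (Rep.trivial ℚ G M)
  exact congrArg (fun φ => φ.hom f) h

/-- The bar coboundary at `[x₁|…|xₙ₊₁|q]`, sorted by the faces that affect the last entry. -/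
theorem barD_snoc (n : ℕ) (F : (Fin (n + 1) → G) → M) (x : Fin (n + 1) → G) (q : G) :
    barD (n + 1) F (Fin.snoc x q : Fin (n + 2) → G) =
      barD n (fun y => F (Fin.snoc y q : Fin (n + 1) → G)) x +
        (-1 : ℚ) ^ (n + 1) • (F (Fin.snoc (Fin.init x) (x (Fin.last n) * q) : Fin (n + 1) → G) -
          F (Fin.snoc (Fin.init x) q : Fin (n + 1) → G)) + (-1 : ℚ) ^ (n + 2) • F x := by
  have h0 : (fun i => (Fin.snoc x q : Fin (n + 2) → G) i.succ) =
      (Fin.snoc (fun i => x i.succ) q : Fin (n + 1) → G) := by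
    funext i
    refine Fin.lastCases ?_ (fun i => ?_) i
    · simp
    · simp only [Fin.snoc_castSucc, ← Fin.castSucc_succ]
  have h1 (j : Fin n) :
      Fin.contractNth j.castSucc.castSucc (· * ·) (Fin.snoc x q : Fin (n + 2) → G) =
      (Fin.snoc (Fin.contractNth j.castSucc (· * ·) x) q : Fin (n + 1) → G) := by
    funext i
    refine Fin.lastCases ?_ (fun i => ?_) i
    · have h2 : ¬ (n < (j : ℕ)) := by omega
      have h3 : ¬ (n = (j : ℕ)) := by omega
      simp [Fin.contractNth, h2, h3]
    · simp only [Fin.contractNth, Fin.snoc_castSucc, Fin.val_castSucc, ← Fin.castSucc_succ]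
  have h2 : Fin.contractNth (Fin.last n).castSucc (· * ·) (Fin.snoc x q : Fin (n + 2) → G) =
      (Fin.snoc (Fin.init x) (x (Fin.last n) * q) : Fin (n + 1) → G) := by
    funext i
    refine Fin.lastCases ?_ (fun i => ?_) i
    · simp [Fin.contractNth]
    · simp [Fin.init, Fin.contractNth]
  have h3 : Fin.contractNth (Fin.last (n + 1)) (· * ·) (Fin.snoc x q : Fin (n + 2) → G) = x := by
    funext i
    have : (i : ℕ) < n + 1 := i.2
    simp [Fin.contractNth, this]
  have h4 : Fin.contractNth (Fin.last n) (· * ·) x = Fin.init x := by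
    funext i
    simp [Fin.init, Fin.contractNth]
  unfold barD
  rw [Fin.sum_univ_castSucc, Fin.sum_univ_castSucc, Fin.sum_univ_castSucc (n := n)]
  simp only [h0, h1, h2, h3, h4, Fin.val_castSucc, Fin.val_last]
  rw [smul_sub]
  abel

/-- The bar coboundary with coefficients in functions on `Γ`, where the last face is twisted by left
multiplication by `s` of the last entry. -/
def twistedD {Γ : Type} [Group Γ] (s : G → Γ) (n : ℕ) (f : (Fin n → G) → Γ → M)
    (x : Fin (n + 1) → G) (γ : Γ) : M :=
  barD n (fun y => f y γ) x +
    (-1 : ℚ) ^ (n + 1) • (f (Fin.init x) (s (x (Fin.last n)) * γ) - f (Fin.init x) γ)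

theorem map_barD {N : Type} [AddCommGroup N] [Module ℚ N] (φ : M →ₗ[ℚ] N) (n : ℕ)
    (f : (Fin n → G) → M) (x : Fin (n + 1) → G) :
    φ (barD n f x) = barD n (fun y => φ (f y)) x := by
  simp [barD]

theorem barD_add (n : ℕ) (f h : (Fin n → G) → M) (x : Fin (n + 1) → G) :
    barD n (fun y => f y + h y) x = barD n f x + barD n h x := by
  simp only [barD, smul_add, Finset.sum_add_distrib]
  abel

theorem barD_sub (n : ℕ) (f h : (Fin n → G) → M) (x : Fin (n + 1) → G) :
    barD n (fun y => f y - h y) x = barD n f x - barD n h x := by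
  simp only [barD, smul_sub, Finset.sum_sub_distrib]
  abel

theorem barD_smul (n : ℕ) (r : ℚ) (f : (Fin n → G) → M) (x : Fin (n + 1) → G) :
    barD n (fun y => r • f y) x = r • barD n f x := by
  simp only [barD, smul_add, Finset.smul_sum, smul_comm r]

theorem map_twistedD {Γ : Type} [Group Γ] (s : G → Γ) {N : Type} [AddCommGroup N] [Module ℚ N]
    (φ : M →ₗ[ℚ] N) (n : ℕ) (f : (Fin n → G) → Γ → M) (x : Fin (n + 1) → G) (γ : Γ) :
    φ (twistedD s n f x γ) = twistedD s n (fun y δ => φ (f y δ)) x γ := by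
  simp [twistedD, map_barD]

/-- The untwisted parts cancel by `barD_barD`; what survives is exactly the failure of s to be
multiplicative on the last two entries. -/
theorem twistedD_twistedD {Γ : Type} [Group Γ] (s : G → Γ) (n : ℕ) (f : (Fin n → G) → Γ → M)
    (x : Fin (n + 2) → G) (γ : Γ) :
    twistedD s (n + 1) (twistedD s n f) x γ =
      f (front x) (s (x (Fin.last n).castSucc * x (Fin.last (n + 1))) * γ) -
        f (front x) (s (x (Fin.last n).castSucc) * (s (x (Fin.last (n + 1))) * γ)) := by
  obtain ⟨x, q, rfl⟩ : ∃ (y : Fin (n + 1) → G) (q : G), x = (Fin.snoc y q : Fin (n + 2) → G) :=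
    ⟨Fin.init x, x (Fin.last _), (Fin.snoc_init_self x).symm⟩
  have hfront : front (Fin.snoc x q : Fin (n + 2) → G) = Fin.init x := by
    funext i
    simp [Fin.init, front]
  have h := congrFun (barD_barD n (fun y => f y γ)) (Fin.snoc x q : Fin (n + 2) → G)
  simp only [twistedD, hfront, barD_add, barD_sub, barD_smul, h, Fin.init_snoc, Fin.snoc_last,
    Fin.snoc_castSucc, Pi.zero_apply]
  simp only [barD_snoc, Fin.init_snoc, Fin.snoc_last]
  have e' : ((-1 : ℚ) ^ (n + 1)) * ((-1) ^ (n + 1)) = 1 := by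
    rw [← mul_pow]; simp
  have e2 : (-1 : ℚ) ^ (n + 2) = - (-1) ^ (n + 1) := by ring
  rw [e2]
  -- Only ε = ±1 matters about the sign; for each value the identity is linear.
  generalize (-1 : ℚ) ^ (n + 1) = ε at e' ⊢
  obtain rfl | rfl := mul_self_eq_one_iff.1 e' <;> module

end Bar

/-! ### Twisted bar chains over ℚ[Γ] and their contraction modulo g - 1 -/

section

variable {Γ : Type} [Group Γ] {Y : Type}

/-- Left multiplication by `a` on the free module with basis `Y × Γ`. -/
def translate (Y : Type) (a : Γ) : (Y × Γ →₀ ℚ) →ₗ[ℚ] (Y × Γ →₀ ℚ) :=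
  Finsupp.lmapDomain ℚ ℚ fun p => (p.1, a * p.2)

@[simp]
theorem translate_single (a : Γ) (y : Y) (γ : Γ) (r : ℚ) :
    translate Y a (Finsupp.single (y, γ) r) = Finsupp.single (y, a * γ) r := by
  simp [translate]

/-- The free module with basis `Y × Γ`, where `Γ` acts on itself by inverse right multiplication. -/
def freeRep (Γ : Type) [Group Γ] (Y : Type) : Representation ℚ Γ (Y × Γ →₀ ℚ) where
  toFun a := Finsupp.lmapDomain ℚ ℚ fun p => (p.1, p.2 * a⁻¹)
  map_one' := by
    refine Finsupp.lhom_ext fun p r => ?_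
    simp
  map_mul' a b := by
    refine Finsupp.lhom_ext fun p r => ?_
    simp [mul_assoc]

@[simp]
theorem freeRep_single (a : Γ) (y : Y) (γ : Γ) (r : ℚ) :
    freeRep Γ Y a (Finsupp.single (y, γ) r) = Finsupp.single (y, γ * a⁻¹) r := by
  simp [freeRep]

variable (g : CentralElement Γ)

/-- Multiplication by `g - 1`. -/
def CentralElement.shift (Y : Type) : (Y × Γ →₀ ℚ) →ₗ[ℚ] (Y × Γ →₀ ℚ) :=
  translate Y g.val - LinearMap.id

@[simp]
theorem CentralElement.shift_single (y : Y) (γ : Γ) (r : ℚ) :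
    g.shift Y (Finsupp.single (y, γ) r) =
      Finsupp.single (y, g.val * γ) r - Finsupp.single (y, γ) r := by
  simp [CentralElement.shift]

/-- A chain fixed by g has support stable under g, which has infinite order and acts freely; a
finite support must then be empty. -/
theorem CentralElement.shift_injective : Function.Injective (g.shift Y) := by
  rw [injective_iff_map_eq_zero]
  intro a ha
  have hinv (p : Y × Γ) : a (p.1, g.val * p.2) = a p := by
    have h := DFunLike.congr_fun (sub_eq_zero.1 ha : translate Y g.val a = a) (p.1, g.val * p.2)
    rw [← h]
    exact Finsupp.mapDomain_apply (f := fun p : Y × Γ => (p.1, g.val * p.2))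
      (fun p q h => Prod.ext (Prod.ext_iff.1 h).1 (mul_left_cancel (Prod.ext_iff.1 h).2)) a p
  have hpow (p : Y × Γ) (k : ℕ) : a (p.1, g.val ^ k * p.2) = a p := by
    induction k with
    | zero => simp
    | succ k ih => rw [pow_succ', mul_assoc, hinv (p.1, g.val ^ k * p.2), ih]
  ext p
  by_contra hp
  refine Set.infinite_of_injective_forall_mem (f := fun k : ℕ => (p.1, g.val ^ k * p.2))
    (s := (a.support : Set (Y × Γ))) ?_ (fun k => ?_) a.support.finite_toSet
  · intro i j hij
    have h : g.val ^ i = g.val ^ j := mul_right_cancel (Prod.ext_iff.1 hij).2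
    exact_mod_cast g.zpow_injective (a₁ := (i : ℤ)) (a₂ := (j : ℤ)) (by simpa using h)
  · simpa [hpow p k] using hp

/-- The multiple of `[y]γ` by the Laurent polynomial `(g ^ k - 1) / (g - 1)`. -/
def CentralElement.geom (y : Y) (k : ℤ) (γ : Γ) : Y × Γ →₀ ℚ :=
  ∑ i ∈ Finset.Ico 0 k, Finsupp.single (y, g.val ^ i * γ) 1 -
    ∑ i ∈ Finset.Ico k 0, Finsupp.single (y, g.val ^ i * γ) 1

theorem sum_Ico_telescope {M : Type} [AddCommGroup M] (f : ℤ → M) (m n : ℤ) (h : m ≤ n) :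
    ∑ i ∈ Finset.Ico m n, (f (1 + i) - f i) = f n - f m := by
  induction n, h using Int.leInduction with
  | base => simp
  | succ n hn ih => rw [← Finset.insert_Ico_right_eq_Ico_add_one hn, Finset.sum_insert (by simp), ih,
      add_comm n 1]; abel

theorem CentralElement.shift_geom (y : Y) (k : ℤ) (γ : Γ) :
    g.shift Y (g.geom y k γ) =
      Finsupp.single (y, g.val ^ k * γ) 1 - Finsupp.single (y, γ) 1 := by
  have h (i : ℤ) : g.shift Y (Finsupp.single (y, g.val ^ i * γ) 1) =
      Finsupp.single (y, g.val ^ (1 + i) * γ) 1 - Finsupp.single (y, g.val ^ i * γ) 1 := by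
    rw [g.shift_single, zpow_one_add, mul_assoc]
  rw [CentralElement.geom, map_sub, map_sum, map_sum]
  simp only [h]
  rcases le_total 0 k with hk | hk
  · rw [sum_Ico_telescope (fun i => (Finsupp.single (y, g.val ^ i * γ) 1 : Y × Γ →₀ ℚ)) 0 k hk,
      Finset.Ico_eq_empty_of_le hk]
    simp
  · rw [sum_Ico_telescope (fun i => (Finsupp.single (y, g.val ^ i * γ) 1 : Y × Γ →₀ ℚ)) k 0 hk,
      Finset.Ico_eq_empty_of_le hk]
    simp

/-- The value on `geom` of a functional that does not depend on the `Γ`-coordinate. -/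
theorem CentralElement.linearCombination_geom (f : Y → ℚ) (y : Y) (k : ℤ) (γ : Γ) :
    Finsupp.linearCombination ℚ (fun p : Y × Γ => f p.1) (g.geom y k γ) = k * f y := by
  simp only [CentralElement.geom, map_sub, map_sum, Finsupp.linearCombination_single, one_smul,
    Finset.sum_const, Int.card_Ico, nsmul_eq_mul]
  rw [← sub_mul]
  congr 1
  rcases le_total 0 k with hk | hk
  · lift k to ℕ using hk
    simp
  · obtain ⟨m, rfl⟩ : ∃ m : ℕ, k = -m := ⟨k.natAbs, by omega⟩
    simp

/-- Bar chains of the quotient with coefficients in `ℚ[Γ]`. -/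
abbrev CentralElement.TwistedChains (n : ℕ) : Type := (Fin n → g.BaseGroup) × Γ →₀ ℚ

/-- The twisted bar boundary. It does not square to zero, as the lift is not multiplicative. -/
def CentralElement.boundary (n : ℕ) : g.TwistedChains (n + 1) →ₗ[ℚ] g.TwistedChains n :=
  Finsupp.linearCombination ℚ fun p =>
    twistedD g.lift n (fun y δ => (Finsupp.single (y, δ) 1 : g.TwistedChains n)) p.1 p.2

/-- The quotient by `g - 1` of the square of the twisted bar boundary. -/
def CentralElement.divided (n : ℕ) : g.TwistedChains (n + 2) →ₗ[ℚ] g.TwistedChains n :=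
  Finsupp.linearCombination ℚ fun p =>
    -g.geom (front p.1) (g.eulerFun (p.1 (Fin.last n).castSucc) (p.1 (Fin.last (n + 1))))
      (g.lift (p.1 (Fin.last n).castSucc * p.1 (Fin.last (n + 1))) * p.2)

theorem CentralElement.boundary_single (n : ℕ) (x : Fin (n + 1) → g.BaseGroup) (γ : Γ) :
    g.boundary n (Finsupp.single (x, γ) 1) =
      twistedD g.lift n (fun y δ => (Finsupp.single (y, δ) 1 : g.TwistedChains n)) x γ := by
  simp [CentralElement.boundary]

theorem CentralElement.divided_single (n : ℕ) (x : Fin (n + 2) → g.BaseGroup) (γ : Γ) :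
    g.divided n (Finsupp.single (x, γ) 1) =
    -g.geom (front x) (g.eulerFun (x (Fin.last n).castSucc) (x (Fin.last (n + 1))))
      (g.lift (x (Fin.last n).castSucc * x (Fin.last (n + 1))) * γ) := by
  simp [CentralElement.divided]

theorem lhom_ext_single_one {X M : Type} [AddCommGroup M] [Module ℚ M] {f h : (X →₀ ℚ) →ₗ[ℚ] M}
    (H : ∀ x, f (Finsupp.single x 1) = h (Finsupp.single x 1)) : f = h :=
  Finsupp.lhom_ext' fun x => LinearMap.ext_ring (H x)

/-- With s(p)s(q) = g^k s(pq), the defect s(pq) - s(p)s(q) equals -(g^k - 1)s(pq), which `geom`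
divides by g - 1. -/
theorem CentralElement.boundary_comp_boundary (n : ℕ) :
    g.boundary n ∘ₗ g.boundary (n + 1) = g.shift _ ∘ₗ g.divided n := by
  refine lhom_ext_single_one fun ⟨x, γ⟩ => ?_
  rw [LinearMap.comp_apply, LinearMap.comp_apply, boundary_single, divided_single, map_twistedD,
    map_neg, shift_geom]
  simp only [boundary_single]
  rw [twistedD_twistedD, ← mul_assoc (g.lift _) (g.lift _), g.eulerFun_spec, mul_assoc]
  abel

theorem CentralElement.boundary_comp_shift (n : ℕ) :
    g.boundary n ∘ₗ g.shift _ = g.shift _ ∘ₗ g.boundary n := by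
  refine lhom_ext_single_one fun ⟨x, γ⟩ => ?_
  have h (q : g.BaseGroup) : g.lift q * (g.val * γ) = g.val * (g.lift q * γ) := by
    have := g.comm (g.lift q) 1
    rw [zpow_one] at this
    rw [← mul_assoc, this, mul_assoc]
  rw [LinearMap.comp_apply, LinearMap.comp_apply, shift_single, map_sub, boundary_single,
    boundary_single, CentralElement.shift, LinearMap.sub_apply, map_twistedD, LinearMap.id_apply]
  simp only [translate_single, twistedD, h]

theorem CentralElement.boundary_comp_freeRep (n : ℕ) (a : Γ) :
    g.boundary n ∘ₗ freeRep Γ _ a = freeRep Γ _ a ∘ₗ g.boundary n := by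
  refine lhom_ext_single_one fun ⟨x, γ⟩ => ?_
  rw [LinearMap.comp_apply, LinearMap.comp_apply, freeRep_single, boundary_single,
    boundary_single, map_twistedD]
  simp only [freeRep_single, twistedD, mul_assoc]

theorem CentralElement.shift_comp_freeRep (a : Γ) :
    g.shift Y ∘ₗ freeRep Γ Y a = freeRep Γ Y a ∘ₗ g.shift Y := by
  refine lhom_ext_single_one fun ⟨x, γ⟩ => ?_
  simp [mul_assoc]

/-- This spares all computation with `geom`: since (g - 1)h = ∂², whatever commutes with both ∂ and
g - 1 commutes with h after multiplication by g - 1, hence before it. -/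
theorem CentralElement.shift_comp_cancel {M : Type} [AddCommGroup M] [Module ℚ M]
    {f h : M →ₗ[ℚ] (Y × Γ →₀ ℚ)} (H : g.shift Y ∘ₗ f = g.shift Y ∘ₗ h) : f = h :=
  LinearMap.ext fun m => g.shift_injective (LinearMap.congr_fun H m)

theorem CentralElement.divided_comp_freeRep (n : ℕ) (a : Γ) :
    g.divided n ∘ₗ freeRep Γ _ a = freeRep Γ _ a ∘ₗ g.divided n := by
  apply g.shift_comp_cancel
  rw [← LinearMap.comp_assoc, ← boundary_comp_boundary, LinearMap.comp_assoc,
    boundary_comp_freeRep, ← LinearMap.comp_assoc, boundary_comp_freeRep, LinearMap.comp_assoc,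
    boundary_comp_boundary, ← LinearMap.comp_assoc, ← shift_comp_freeRep, LinearMap.comp_assoc]

theorem CentralElement.divided_comp_shift (n : ℕ) :
    g.divided n ∘ₗ g.shift _ = g.shift _ ∘ₗ g.divided n := by
  apply g.shift_comp_cancel
  rw [← LinearMap.comp_assoc, ← boundary_comp_boundary, LinearMap.comp_assoc,
    boundary_comp_shift, ← LinearMap.comp_assoc, boundary_comp_shift, LinearMap.comp_assoc]

theorem CentralElement.divided_comp_boundary (n : ℕ) :
    g.divided n ∘ₗ g.boundary (n + 2) = g.boundary n ∘ₗ g.divided (n + 1) := by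
  apply g.shift_comp_cancel
  rw [← LinearMap.comp_assoc, ← boundary_comp_boundary, LinearMap.comp_assoc,
    boundary_comp_boundary, ← LinearMap.comp_assoc, boundary_comp_shift, LinearMap.comp_assoc]

/-- A contraction of the twisted bar chains modulo `g - 1`. -/
def CentralElement.contraction (n : ℕ) : g.TwistedChains n →ₗ[ℚ] g.TwistedChains (n + 1) :=
  Finsupp.linearCombination ℚ fun p =>
    (-1 : ℚ) ^ (n + 1) • Finsupp.single
      ((Fin.snoc p.1 (p.2 : g.BaseGroup) : Fin (n + 1) → g.BaseGroup), (1 : Γ)) (1 : ℚ)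

theorem CentralElement.contraction_single (n : ℕ) (x : Fin n → g.BaseGroup) (γ : Γ) :
    g.contraction n (Finsupp.single (x, γ) 1) = (-1 : ℚ) ^ (n + 1) • Finsupp.single
      ((Fin.snoc x (γ : g.BaseGroup) : Fin (n + 1) → g.BaseGroup), (1 : Γ)) (1 : ℚ) := by
  simp [CentralElement.contraction]

theorem CentralElement.contraction_shift (n : ℕ) : g.contraction n ∘ₗ g.shift _ = 0 := by
  refine lhom_ext_single_one fun ⟨x, γ⟩ => ?_
  have h : ((g.val * γ : Γ) : g.BaseGroup) = (γ : g.BaseGroup) := by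
    have hg : (g.val : g.BaseGroup) = 1 :=
      (QuotientGroup.eq_one_iff _).2 (Subgroup.mem_zpowers _)
    rw [QuotientGroup.mk_mul, hg, one_mul]
  rw [LinearMap.comp_apply, shift_single, map_sub, contraction_single, contraction_single, h,
    sub_self, LinearMap.zero_apply]

/-- An element of Γ and the chosen lift of its class differ by a power of g, and g^k - 1 is a
multiple of g - 1. -/
theorem CentralElement.single_sub_single_lift_mem (y : Y) (γ : Γ) :
    (Finsupp.single (y, γ) 1 - Finsupp.single (y, g.lift (γ : g.BaseGroup)) 1 : Y × Γ →₀ ℚ) ∈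
      LinearMap.range (g.shift Y) := by
  obtain ⟨k, hk⟩ := QuotientGroup.eq.1 (g.mk_lift (γ : g.BaseGroup))
  refine ⟨g.geom y k (g.lift (γ : g.BaseGroup)), ?_⟩
  rw [shift_geom, ← g.comm]
  congr 3
  rw [show g.val ^ k = _ from hk, mul_inv_cancel_left]

/-- Modulo g - 1 the coefficients become ℚ[G] and the complex is the bar resolution of G, contracted
by moving the coefficient into a new last entry. The last face restores the coefficient as its lift,
so the error is γ minus the lift of its class. -/
theorem CentralElement.contraction_homotopy (n : ℕ) (a : g.TwistedChains (n + 1)) :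
    a - g.boundary (n + 1) (g.contraction (n + 1) a) - g.contraction n (g.boundary n a) ∈
      LinearMap.range (g.shift _) := by
  suffices h : (LinearMap.range (g.shift _)).mkQ ∘ₗ (LinearMap.id -
      g.boundary (n + 1) ∘ₗ g.contraction (n + 1) - g.contraction n ∘ₗ g.boundary n) = 0 by
    exact (Submodule.Quotient.mk_eq_zero _).1 (LinearMap.congr_fun h a)
  refine lhom_ext_single_one fun ⟨x, γ⟩ => (Submodule.Quotient.mk_eq_zero _).2 ?_
  convert g.single_sub_single_lift_mem x γ using 1
  simp only [LinearMap.sub_apply, LinearMap.comp_apply, LinearMap.id_apply, contraction_single,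
    boundary_single, map_smul, map_twistedD]
  simp only [twistedD, barD_snoc, barD_smul, Fin.init_snoc, Fin.snoc_last, QuotientGroup.mk_mul,
    mk_lift, mul_one]
  have e' : ((-1 : ℚ) ^ (n + 1)) * ((-1) ^ (n + 1)) = 1 := by
    rw [← mul_pow]; simp
  have e2 : (-1 : ℚ) ^ (n + 2) = - (-1) ^ (n + 1) := by ring
  rw [e2]
  generalize (-1 : ℚ) ^ (n + 1) = ε at e' ⊢
  obtain rfl | rfl := mul_self_eq_one_iff.1 e' <;> module

/-- The sum of the coefficients. -/
def CentralElement.augmentation : g.TwistedChains 0 →ₗ[ℚ] ℚ :=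
  Finsupp.linearCombination ℚ fun _ => 1

theorem CentralElement.augmentation_single (p : (Fin 0 → g.BaseGroup) × Γ) (r : ℚ) :
    g.augmentation (Finsupp.single p r) = r := by
  simp [CentralElement.augmentation]

theorem CentralElement.augmentation_comp_shift : g.augmentation ∘ₗ g.shift _ = 0 := by
  refine lhom_ext_single_one fun ⟨x, γ⟩ => ?_
  rw [LinearMap.comp_apply, shift_single, map_sub, augmentation_single, augmentation_single]
  simp

theorem CentralElement.augmentation_comp_boundary : g.augmentation ∘ₗ g.boundary 0 = 0 := by
  refine lhom_ext_single_one fun ⟨x, γ⟩ => ?_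
  rw [LinearMap.comp_apply, boundary_single, map_twistedD]
  simp [twistedD, augmentation_single, barD]

/-- In degree 0 the augmentation, followed by the inclusion of the base point, takes the place of
the missing lower term of the homotopy. -/
theorem CentralElement.contraction_homotopy_zero (a : g.TwistedChains 0) :
    a - g.boundary 0 (g.contraction 0 a) - g.augmentation a • Finsupp.single (default, 1) 1 ∈
      LinearMap.range (g.shift _) := by
  suffices h : (LinearMap.range (g.shift _)).mkQ ∘ₗ (LinearMap.id -
      g.boundary 0 ∘ₗ g.contraction 0 - g.augmentation.smulRight (Finsupp.single (default, 1) 1)) = 0 by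
    exact (Submodule.Quotient.mk_eq_zero _).1 (LinearMap.congr_fun h a)
  refine lhom_ext_single_one fun ⟨x, γ⟩ => (Submodule.Quotient.mk_eq_zero _).2 ?_
  convert g.single_sub_single_lift_mem x γ using 1
  obtain rfl : x = default := Subsingleton.elim _ _
  have hs (y : Fin 0 → g.BaseGroup) : y = default := Subsingleton.elim _ _
  simp only [LinearMap.sub_apply, LinearMap.comp_apply, LinearMap.id_apply, contraction_single,
    boundary_single, map_smul, twistedD, LinearMap.smulRight_apply, augmentation_single, barD, hs,
    Fin.snoc_zero, mul_one]
  simp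
  abel

end

/-! ### The free resolution of ℚ over ℚ[Γ] -/

section

variable {Γ : Type} [Group Γ]

/-- The action on the Γ-coordinate is simply transitive, so the elements (y, 1) are a basis over
ℚ[Γ] and a lift may be chosen on them freely. -/
theorem freeRep_projective (Y : Type) : Projective (Rep.of (freeRep Γ Y)) where
  factors {E X} f e he := by
    have hs := (Rep.epi_iff_surjective e).1 he
    choose t ht using fun y : Y => hs (f.hom (Finsupp.single (y, 1) 1))
    have key (y : Y) (γ : Γ) : f.hom (Finsupp.single (y, γ) 1) =
        X.ρ γ⁻¹ (f.hom (Finsupp.single (y, 1) 1)) := by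
      rw [← Rep.hom_comm_apply]
      congr 1
      simp
    let φ : (Y × Γ →₀ ℚ) →ₗ[ℚ] E :=
      Finsupp.linearCombination ℚ fun p => E.ρ p.2⁻¹ (t p.1)
    have hφ (y : Y) (γ : Γ) : φ (Finsupp.single (y, γ) 1) = E.ρ γ⁻¹ (t y) := by
      simp [φ]
    refine ⟨Rep.ofHom (σ := E.ρ) ⟨φ, fun a => ?_⟩, ?_⟩
    · refine lhom_ext_single_one fun ⟨y, γ⟩ => ?_
      rw [LinearMap.comp_apply, LinearMap.comp_apply, freeRep_single, hφ, hφ]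
      simp
    · ext1
      apply Representation.IntertwiningMap.ext
      refine lhom_ext_single_one fun ⟨y, γ⟩ => ?_
      change e.hom (φ (Finsupp.single (y, γ) 1)) = f.hom (Finsupp.single (y, γ) 1)
      rw [hφ, Rep.hom_comm_apply, ht]
      exact (key y γ).symm

theorem prod_projective {A B : Rep.{0} ℚ Γ} (hA : Projective A) (hB : Projective B) :
    Projective (Rep.of (A.ρ.prod B.ρ)) where
  factors {E X} f e _ := by
    let i : A ⟶ Rep.of (A.ρ.prod B.ρ) := Rep.ofHom (.inl ℚ A.ρ B.ρ)
    let j : B ⟶ Rep.of (A.ρ.prod B.ρ) := Rep.ofHom (.inr ℚ A.ρ B.ρ)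
    let p : Rep.of (A.ρ.prod B.ρ) ⟶ A := Rep.ofHom (.fst ℚ A.ρ B.ρ)
    let q : Rep.of (A.ρ.prod B.ρ) ⟶ B := Rep.ofHom (.snd ℚ A.ρ B.ρ)
    have h : p ≫ i + q ≫ j = 𝟙 _ := by
      ext1
      simp [Rep.add_hom, p, q, i, j]
    refine ⟨p ≫ Projective.factorThru (i ≫ f) e + q ≫ Projective.factorThru (j ≫ f) e, ?_⟩
    rw [Preadditive.add_comp, Category.assoc, Category.assoc, Projective.factorThru_comp,
      Projective.factorThru_comp, ← Category.assoc, ← Category.assoc, ← Preadditive.add_comp, h,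
      Category.id_comp]

variable (g : CentralElement Γ)

/-- The terms of the resolution: twisted bar chains of the quotient, tensored with the two-term
resolution of the infinite cyclic group generated by `g`. -/
def CentralElement.resolutionX : ℕ → Rep.{0} ℚ Γ
  | 0 => Rep.of (freeRep Γ (Fin 0 → g.BaseGroup))
  | n + 1 => Rep.of ((freeRep Γ (Fin (n + 1) → g.BaseGroup)).prod (freeRep Γ (Fin n → g.BaseGroup)))

/-- The differential `(a, b) ↦ ∂a + (g - 1)b` in the lowest degree. -/
def CentralElement.resolutionDZero : g.TwistedChains 1 × g.TwistedChains 0 →ₗ[ℚ] g.TwistedChains 0 :=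
  (g.boundary 0).coprod (g.shift _)

/-- The differential `(a, b) ↦ (∂a + (g - 1)b, -∂b - ha)`, where `(g - 1)h = ∂²`. -/
def CentralElement.resolutionDSucc (n : ℕ) :
    g.TwistedChains (n + 2) × g.TwistedChains (n + 1) →ₗ[ℚ]
      g.TwistedChains (n + 1) × g.TwistedChains n :=
  ((g.boundary (n + 1)).coprod (g.shift _)).prod ((-g.divided n).coprod (-g.boundary n))

/-- The differential of the resolution. -/
def CentralElement.resolutionD : (n : ℕ) → (g.resolutionX (n + 1) ⟶ g.resolutionX n)
  | 0 => Rep.ofHom (ρ := (freeRep Γ (Fin 1 → g.BaseGroup)).prod (freeRep Γ (Fin 0 → g.BaseGroup)))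
      (σ := freeRep Γ (Fin 0 → g.BaseGroup)) ⟨g.resolutionDZero, fun a => by
      refine LinearMap.ext fun ⟨x, y⟩ => ?_
      have h1 := LinearMap.congr_fun (g.boundary_comp_freeRep 0 a) x
      have h2 := LinearMap.congr_fun (g.shift_comp_freeRep a) y
      simp only [LinearMap.comp_apply] at h1 h2
      simp [resolutionDZero, h1, h2]⟩
  | n + 1 => Rep.ofHom
      (ρ := (freeRep Γ (Fin (n + 2) → g.BaseGroup)).prod (freeRep Γ (Fin (n + 1) → g.BaseGroup)))
      (σ := (freeRep Γ (Fin (n + 1) → g.BaseGroup)).prod (freeRep Γ (Fin n → g.BaseGroup)))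
      ⟨g.resolutionDSucc n, fun a => by
      refine LinearMap.ext fun ⟨x, y⟩ => ?_
      have h1 := LinearMap.congr_fun (g.boundary_comp_freeRep (n + 1) a) x
      have h2 := LinearMap.congr_fun (g.shift_comp_freeRep a) y
      have h3 := LinearMap.congr_fun (g.boundary_comp_freeRep n a) y
      have h4 := LinearMap.congr_fun (g.divided_comp_freeRep n a) x
      simp only [LinearMap.comp_apply] at h1 h2 h3 h4
      simp [resolutionDSucc, h1, h2, h3, h4]⟩

theorem CentralElement.resolutionD_comp (n : ℕ) :
    g.resolutionD (n + 1) ≫ g.resolutionD n = 0 := by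
  ext1
  apply Representation.IntertwiningMap.ext
  refine LinearMap.ext fun x => ?_
  cases n with
  | zero =>
    obtain ⟨a, b⟩ : g.TwistedChains 2 × g.TwistedChains 1 := x
    change g.resolutionDZero (g.resolutionDSucc 0 (a, b)) = 0
    have h1 := LinearMap.congr_fun (g.boundary_comp_boundary 0) a
    have h2 := LinearMap.congr_fun (g.boundary_comp_shift 0) b
    simp only [LinearMap.comp_apply] at h1 h2
    simp [resolutionDZero, resolutionDSucc, h1, h2]
    abel
  | succ n =>
    obtain ⟨a, b⟩ : g.TwistedChains (n + 3) × g.TwistedChains (n + 2) := x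
    change g.resolutionDSucc n (g.resolutionDSucc (n + 1) (a, b)) = 0
    have h1 := LinearMap.congr_fun (g.boundary_comp_boundary (n + 1)) a
    have h2 := LinearMap.congr_fun (g.boundary_comp_shift (n + 1)) b
    have h3 := LinearMap.congr_fun (g.boundary_comp_boundary n) b
    have h4 := LinearMap.congr_fun (g.divided_comp_boundary n) a
    have h5 := LinearMap.congr_fun (g.divided_comp_shift n) b
    simp only [LinearMap.comp_apply] at h1 h2 h3 h4 h5
    simp [resolutionDSucc, h1, h2, h3, h4, h5]
    constructor <;> abel

/-- A chain complex of free `ℚ[Γ]`-modules that resolves `ℚ`. -/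
def CentralElement.resolutionComplex : ChainComplex (Rep.{0} ℚ Γ) ℕ :=
  ChainComplex.of g.resolutionX g.resolutionD g.resolutionD_comp

theorem CentralElement.resolutionComplex_d (n : ℕ) :
    g.resolutionComplex.d (n + 1) n = g.resolutionD n :=
  ChainComplex.of_d _ _ _

theorem CentralElement.resolutionX_projective (n : ℕ) : Projective (g.resolutionX n) := by
  cases n with
  | zero => exact freeRep_projective _
  | succ n => exact prod_projective (freeRep_projective _) (freeRep_projective _)

/-- The augmentation of the resolution. -/
def CentralElement.resolutionε : g.resolutionComplex.X 0 ⟶ Rep.trivial ℚ Γ ℚ :=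
  Rep.ofHom (ρ := freeRep Γ (Fin 0 → g.BaseGroup)) ⟨g.augmentation, fun a => by
    refine lhom_ext_single_one fun ⟨y, γ⟩ => ?_
    rw [LinearMap.comp_apply, freeRep_single, augmentation_single]
    simp [augmentation_single]⟩

theorem CentralElement.resolution_d_ε : g.resolutionComplex.d 1 0 ≫ g.resolutionε = 0 := by
  rw [resolutionComplex_d]
  ext1
  apply Representation.IntertwiningMap.ext
  refine LinearMap.ext fun x => ?_
  obtain ⟨a, b⟩ : g.TwistedChains 1 × g.TwistedChains 0 := x
  change g.augmentation (g.resolutionDZero (a, b)) = 0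
  have h1 := LinearMap.congr_fun g.augmentation_comp_boundary a
  have h2 := LinearMap.congr_fun g.augmentation_comp_shift b
  simp only [LinearMap.comp_apply] at h1 h2
  simp [resolutionDZero, h1, h2]

theorem CentralElement.resolution_exact_zero (a : g.TwistedChains 0) (ha : g.augmentation a = 0) :
    ∃ y, g.resolutionDZero y = a := by
  obtain ⟨b, hb⟩ := g.contraction_homotopy_zero a
  refine ⟨(g.contraction 0 a, b), ?_⟩
  rw [ha] at hb
  simp [resolutionDZero, hb]

/-- The hypothesis says that a is a cycle modulo g - 1, and the contraction kills multiples of g -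
1, so the homotopy formula writes a as required. -/
theorem CentralElement.exists_boundary_add_shift (n : ℕ) (a : g.TwistedChains (n + 1))
    (b : g.TwistedChains n) (h : g.boundary n a + g.shift _ b = 0) :
    ∃ a' b', g.boundary (n + 1) a' + g.shift _ b' = a := by
  obtain ⟨b', hb'⟩ := g.contraction_homotopy n a
  refine ⟨g.contraction (n + 1) a, b', ?_⟩
  have h1 := LinearMap.congr_fun (g.contraction_shift n) b
  rw [LinearMap.comp_apply, LinearMap.zero_apply] at h1
  rw [eq_neg_of_add_eq_zero_left h, map_neg, h1] at hb'
  rw [hb']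
  simp

theorem CentralElement.resolution_exact_one (x : g.TwistedChains 1 × g.TwistedChains 0)
    (hx : g.resolutionDZero x = 0) : ∃ y, g.resolutionDSucc 0 y = x := by
  obtain ⟨a, b⟩ := x
  obtain ⟨a', b', h'⟩ := g.exists_boundary_add_shift 0 a b hx
  -- The second coordinate needs no separate choice: two cycles with the same first coordinate have
  -- second coordinates that agree after g - 1, hence agree.
  refine ⟨(a', b'), Prod.ext h' (g.shift_injective ?_)⟩
  have h1 : g.resolutionDZero (g.resolutionDSucc 0 (a', b')) = 0 :=
    congrArg (fun φ => φ.hom (a', b')) (g.resolutionD_comp 0)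
  have h2 : g.resolutionDZero (a, (g.resolutionDSucc 0 (a', b')).2) = 0 := by
    rw [← h1]; congr 1; exact Prod.ext h'.symm rfl
  exact add_left_cancel (h2.trans hx.symm)

theorem CentralElement.resolution_exact_succ (n : ℕ)
    (x : g.TwistedChains (n + 2) × g.TwistedChains (n + 1))
    (hx : g.resolutionDSucc n x = 0) : ∃ y, g.resolutionDSucc (n + 1) y = x := by
  obtain ⟨a, b⟩ := x
  obtain ⟨a', b', h'⟩ := g.exists_boundary_add_shift (n + 1) a b (congrArg Prod.fst hx)
  refine ⟨(a', b'), Prod.ext h' (g.shift_injective ?_)⟩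
  have h1 : g.resolutionDSucc n (g.resolutionDSucc (n + 1) (a', b')) = 0 :=
    congrArg (fun φ => φ.hom (a', b')) (g.resolutionD_comp (n + 1))
  have h2 : g.resolutionDSucc n (a, (g.resolutionDSucc (n + 1) (a', b')).2) = 0 := by
    rw [← h1]; congr 1; exact Prod.ext h'.symm rfl
  exact add_left_cancel (congrArg Prod.fst (h2.trans hx.symm))

/-- The augmentation as a chain map. -/
def CentralElement.resolutionπ :
    g.resolutionComplex ⟶ (ChainComplex.single₀ (Rep.{0} ℚ Γ)).obj (Rep.trivial ℚ Γ ℚ) :=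
  (g.resolutionComplex.toSingle₀Equiv _).symm ⟨g.resolutionε, g.resolution_d_ε⟩

theorem CentralElement.resolutionπ_quasiIso : QuasiIso g.resolutionπ where
  quasiIsoAt m := by
    cases m with
    | zero =>
      rw [ChainComplex.quasiIsoAt₀_iff, ShortComplex.quasiIso_iff_of_zeros' _ rfl rfl rfl]
      constructor
      · apply (forget₂ _ (ModuleCat ℚ)).reflects_exact_of_faithful
        rw [ShortComplex.moduleCat_exact_iff]
        intro (a : g.TwistedChains 0) ha
        obtain ⟨y, hy⟩ := g.resolution_exact_zero a ha
        refine ⟨y, ?_⟩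
        change (g.resolutionComplex.d 1 0).hom y = a
        rw [resolutionComplex_d]
        exact hy
      · rw [Rep.epi_iff_surjective]
        intro x
        exact ⟨Finsupp.single (default, 1) x, g.augmentation_single _ _⟩
    | succ m =>
      rw [quasiIsoAt_iff_exactAt' (hL := ChainComplex.exactAt_succ_single_obj ..),
          HomologicalComplex.exactAt_iff' _ (m + 2) (m + 1) m (by simp) (by simp)]
      apply (forget₂ _ (ModuleCat ℚ)).reflects_exact_of_faithful
      rw [ShortComplex.moduleCat_exact_iff]
      intro x hx
      replace hx : (g.resolutionComplex.d (m + 1) m).hom x = 0 := hx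
      change ∃ y, (g.resolutionComplex.d (m + 2) (m + 1)).hom y = x
      rw [resolutionComplex_d] at hx ⊢
      cases m with
      | zero => exact g.resolution_exact_one x hx
      | succ m => exact g.resolution_exact_succ m x hx

/-- The projective resolution of the trivial representation attached to a central element. -/
def CentralElement.resolution : ProjectiveResolution (Rep.trivial ℚ Γ ℚ) where
  complex := g.resolutionComplex
  projective := g.resolutionX_projective
  π := g.resolutionπ
  quasiIso := g.resolutionπ_quasiIso

end

/-! ### Injectivity of the cup product with the Euler class -/

section

variable {Γ : Type} [Group Γ] (g : CentralElement Γ)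

theorem CentralElement.exists_factorization (n : ℕ)
    (h : Limits.IsZero (groupCohomology (Rep.trivial ℚ Γ ℚ) (n + 1)))
    (Φ : g.resolutionX (n + 1) ⟶ Rep.trivial ℚ Γ ℚ) (hΦ : g.resolutionD (n + 1) ≫ Φ = 0) :
    ∃ Ψ : g.resolutionX n ⟶ Rep.trivial ℚ Γ ℚ, g.resolutionD n ≫ Ψ = Φ := by
  have h1 := h.of_iso (groupCohomologyIso (Rep.trivial ℚ Γ ℚ) (n + 1) g.resolution).symm
  rw [← HomologicalComplex.exactAt_iff_isZero_homology,
    HomologicalComplex.exactAt_iff' _ n (n + 1) (n + 2) (by simp) (by simp),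
    ShortComplex.moduleCat_exact_iff] at h1
  obtain ⟨Ψ, hΨ⟩ := h1 Φ (by
    change g.resolutionComplex.d (n + 2) (n + 1) ≫ Φ = 0
    rw [resolutionComplex_d]
    exact hΦ)
  refine ⟨Ψ, ?_⟩
  rw [← resolutionComplex_d]
  exact hΨ

theorem freeRep_linearCombination {Y : Type} (f : Y → ℚ) (a : Γ) :
    Finsupp.linearCombination ℚ (fun p : Y × Γ => f p.1) ∘ₗ freeRep Γ Y a =
      Finsupp.linearCombination ℚ (fun p : Y × Γ => f p.1) := by
  refine lhom_ext_single_one fun ⟨y, γ⟩ => ?_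
  rw [LinearMap.comp_apply, freeRep_single]
  simp

theorem CentralElement.linearCombination_boundary (n : ℕ) (f : (Fin n → g.BaseGroup) → ℚ) :
    Finsupp.linearCombination ℚ (fun p : (Fin n → g.BaseGroup) × Γ => f p.1) ∘ₗ g.boundary n =
      Finsupp.linearCombination ℚ
        (fun p : (Fin (n + 1) → g.BaseGroup) × Γ => barD n f p.1) := by
  refine lhom_ext_single_one fun ⟨y, γ⟩ => ?_
  rw [LinearMap.comp_apply, boundary_single, map_twistedD]
  simp [twistedD]

theorem CentralElement.linearCombination_shift {Y : Type} (f : Y → ℚ) :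
    Finsupp.linearCombination ℚ (fun p : Y × Γ => f p.1) ∘ₗ g.shift Y = 0 := by
  refine lhom_ext_single_one fun ⟨y, γ⟩ => ?_
  simp

/-- Here the Euler class enters: (g^k - 1)/(g - 1) takes the value k at g = 1, and k is the value of
the Euler cocycle on the last two entries. -/
theorem CentralElement.linearCombination_divided (n : ℕ) (f : (Fin n → g.BaseGroup) → ℚ) :
    Finsupp.linearCombination ℚ (fun p : (Fin n → g.BaseGroup) × Γ => f p.1) ∘ₗ g.divided n =
      -Finsupp.linearCombination ℚ (fun p : (Fin (n + 2) → g.BaseGroup) × Γ =>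
        weight g.eulerCocycle p.1 * f (front p.1)) := by
  refine lhom_ext_single_one fun ⟨y, γ⟩ => ?_
  rw [LinearMap.comp_apply, divided_single, map_neg, linearCombination_geom]
  simp [weight, eulerCocycle]

/-- Injectivity of the cup product with the Euler class, on the level of cochains. -/
theorem CentralElement.exists_primitive (n : ℕ)
    (h : Limits.IsZero (groupCohomology (Rep.trivial ℚ Γ ℚ) (n + 2)))
    (α : (Fin (n + 2) → g.BaseGroup) → ℚ) (β : (Fin (n + 1) → g.BaseGroup) → ℚ)
    (hβ : barD (n + 1) β = 0)
    (hα : barD (n + 2) α = fun x => weight g.eulerCocycle x * β (front x)) :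
    ∃ β' : (Fin n → g.BaseGroup) → ℚ, barD n β' = β := by
  let αl := Finsupp.linearCombination ℚ (fun p : (Fin (n + 2) → g.BaseGroup) × Γ => α p.1)
  let βl := Finsupp.linearCombination ℚ (fun p : (Fin (n + 1) → g.BaseGroup) × Γ => β p.1)
  -- The pair (α, -β) is a cocycle on the resolution: the components of its coboundary are dα - β ∪
  -- e and dβ, both zero.
  let Φ : g.resolutionX (n + 2) ⟶ Rep.trivial ℚ Γ ℚ :=
    Rep.ofHom (ρ := (freeRep Γ (Fin (n + 2) → g.BaseGroup)).prod
      (freeRep Γ (Fin (n + 1) → g.BaseGroup))) ⟨αl.coprod (-βl), fun a => by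
        refine LinearMap.ext fun ⟨x, y⟩ => ?_
        have h1 := LinearMap.congr_fun (freeRep_linearCombination α a) x
        have h2 := LinearMap.congr_fun (freeRep_linearCombination β a) y
        rw [LinearMap.comp_apply] at h1 h2
        simp [αl, βl, h1, h2]⟩
  obtain ⟨Ψ, hΨ⟩ := g.exists_factorization (n + 1) h Φ (by
    ext1
    apply Representation.IntertwiningMap.ext
    refine LinearMap.ext fun x => ?_
    obtain ⟨a, b⟩ : g.TwistedChains (n + 3) × g.TwistedChains (n + 2) := x
    change (αl.coprod (-βl)) (g.resolutionDSucc (n + 1) (a, b)) = 0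
    have h1 := LinearMap.congr_fun (g.linearCombination_boundary _ α) a
    have h2 := LinearMap.congr_fun (g.linearCombination_boundary _ β) b
    have h3 := LinearMap.congr_fun (g.linearCombination_shift α) b
    have h4 := LinearMap.congr_fun (g.linearCombination_divided _ β) a
    rw [LinearMap.comp_apply] at h1 h2 h3 h4
    rw [hα] at h1
    have h0 : Finsupp.linearCombination ℚ (fun p : (Fin (n + 2) → g.BaseGroup) × Γ =>
        (0 : (Fin (n + 2) → g.BaseGroup) → ℚ) p.1) = 0 := lhom_ext_single_one fun p => by simp
    rw [hβ, h0] at h2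
    simp [resolutionDSucc, αl, βl, h1, h2, h3, h4])
  let ψ : g.TwistedChains (n + 1) × g.TwistedChains n →ₗ[ℚ] ℚ := Ψ.hom.toLinearMap
  have hψ (z) : ψ (g.resolutionDSucc n z) = αl z.1 - βl z.2 := by
    rw [sub_eq_add_neg]
    exact congrArg (fun φ => φ.hom z) hΨ
  have hinv (a : Γ) (x y) : ψ (freeRep Γ _ a x, freeRep Γ _ a y) = ψ (x, y) :=
    Rep.hom_comm_apply Ψ a (x, y)
  have hinv₁ (x : Fin (n + 1) → g.BaseGroup) (γ : Γ) :
      ψ (Finsupp.single (x, γ) 1, 0) = ψ (Finsupp.single (x, 1) 1, 0) := by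
    rw [← hinv γ]
    simp
  have hinv₂ (y : Fin n → g.BaseGroup) (γ : Γ) :
      ψ (0, Finsupp.single (y, γ) 1) = ψ (0, Finsupp.single (y, 1) 1) := by
    rw [← hinv γ]
    simp
  -- The primitive is the second component of Ψ. The differential of (0, [x]) is ((g - 1)[x],
  -- -∂[x]); the invariant functional ψ kills the first part, and Φ takes the value -β(x) on (0,
  -- [x]).
  refine ⟨fun y => ψ (0, Finsupp.single (y, 1) 1), funext fun x => ?_⟩
  have h1 := hψ (0, Finsupp.single (x, 1) 1)
  have h2 : ψ (0, g.boundary n (Finsupp.single (x, 1) 1)) =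
      barD n (fun y => ψ (0, Finsupp.single (y, 1) 1)) x := by
    change (ψ ∘ₗ LinearMap.inr ℚ _ _) (g.boundary n (Finsupp.single (x, 1) 1)) = _
    rw [boundary_single, map_twistedD]
    simp [twistedD, hinv₂]
  have h3 : ψ (g.shift _ (Finsupp.single (x, 1) 1), 0) = 0 := by
    change (ψ ∘ₗ LinearMap.inl ℚ _ _) (g.shift _ (Finsupp.single (x, 1) 1)) = _
    rw [shift_single, map_sub, LinearMap.comp_apply, LinearMap.comp_apply, LinearMap.inl_apply,
      LinearMap.inl_apply, hinv₁, sub_self]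
  have h4 : g.resolutionDSucc n (0, Finsupp.single (x, 1) 1) =
      (g.shift _ (Finsupp.single (x, 1) 1), 0) - (0, g.boundary n (Finsupp.single (x, 1) 1)) := by
    simp [resolutionDSucc]
  rw [h4, map_sub, h3, h2] at h1
  simpa [βl] using h1

end

/-! ### Duality, vanishing of homology and nilpotence of the Euler class -/

section

variable {G : Type} [Group G]

/-- The functional on bar chains given by a cochain. -/
def evalChains {n : ℕ} (f : (Fin n → G) → ℚ) : (chains G).X n →ₗ[ℚ] ℚ :=
  Finsupp.linearCombination ℚ f

theorem evalChains_single {n : ℕ} (f : (Fin n → G) → ℚ) (x : Fin n → G) :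
    evalChains f (Finsupp.single x (1 : ℚ) : (Fin n → G) →₀ ℚ) = f x := by
  simp [evalChains]

theorem evalChains_zero {n : ℕ} (v : (chains G).X n) :
    evalChains (0 : (Fin n → G) → ℚ) v = 0 :=
  LinearMap.congr_fun (lhom_ext_single_one (h := (0 : ((Fin n → G) →₀ ℚ) →ₗ[ℚ] ℚ))
    fun x => evalChains_single 0 x) v

theorem chains_lhom_ext {n : ℕ} {f h : (chains G).X n →ₗ[ℚ] ℚ}
    (H : ∀ x, f (Finsupp.single x (1 : ℚ) : (Fin n → G) →₀ ℚ) =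
      h (Finsupp.single x (1 : ℚ) : (Fin n → G) →₀ ℚ)) : f = h :=
  lhom_ext_single_one H

theorem exists_evalChains {n : ℕ} (φ : (chains G).X n →ₗ[ℚ] ℚ) : ∃ f, evalChains f = φ :=
  ⟨fun x => φ (Finsupp.single x (1 : ℚ) : (Fin n → G) →₀ ℚ),
    chains_lhom_ext fun x => evalChains_single _ x⟩

theorem evalChains_injective {n : ℕ} :
    Function.Injective (evalChains : ((Fin n → G) → ℚ) → _) := fun f h H =>
  funext fun x => by rw [← evalChains_single f, H, evalChains_single]

theorem evalChains_comp_d {n : ℕ} (f : (Fin n → G) → ℚ) :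
    evalChains f ∘ₗ ((chains G).d (n + 1) n).hom = evalChains (barD n f) := by
  refine chains_lhom_ext fun x => ?_
  rw [LinearMap.comp_apply, boundary_single, evalChains_single]
  exact (map_barD (evalChains f) n _ x).trans
    (congrArg (fun f => barD n f x) (funext (evalChains_single f)))

theorem evalChains_comp_capChains (c : TwoCocycle G) {n : ℕ} (f : (Fin n → G) → ℚ) :
    evalChains f ∘ₗ (capChains c n).hom = evalChains fun x => weight c x * f (front x) := by
  refine chains_lhom_ext fun x => ?_
  rw [LinearMap.comp_apply, capChains_single, evalChains_single]
  refine (map_smul (evalChains f) _ _).trans ?_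
  rw [evalChains_single, smul_eq_mul]

/-- A functional on the source that vanishes on the kernel extends along the map. -/
theorem exists_comp_eq_of_ker_le {V W : Type} [AddCommGroup V] [Module ℚ V] [AddCommGroup W]
    [Module ℚ W] (d : V →ₗ[ℚ] W) (φ : V →ₗ[ℚ] ℚ) (h : ∀ v, d v = 0 → φ v = 0) :
    ∃ ψ : W →ₗ[ℚ] ℚ, ψ ∘ₗ d = φ := by
  have : φ ∈ LinearMap.range d.dualMap := by
    rw [LinearMap.range_dualMap_eq_dualAnnihilator_ker, Submodule.mem_dualAnnihilator]
    exact h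
  exact this

theorem exists_cycles_of_d_eq_zero {n : ℕ} (v : (chains G).X (n + 1))
    (h : ((chains G).d (n + 1) n).hom v = 0) :
    ∃ z : (chains G).cycles (n + 1), ((chains G).iCycles (n + 1)).hom z = v :=
  ⟨(chains G).cyclesMk v n (by simp) h, (chains G).i_cyclesMk _ _ _ _⟩

/-- Otherwise a nonzero functional on homology kills the image. It is represented by a cocycle β
whose cup product with the Euler cocycle is a coboundary, so β is a coboundary and the functional is
zero. -/
theorem capHomology_surjective {Γ : Type} [Group Γ] (g : CentralElement Γ) (n : ℕ)
    (hn : n ≠ 0) (h : Limits.IsZero (groupCohomology (Rep.trivial ℚ Γ ℚ) (n + 1))) :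
    Function.Surjective (capHomology g.eulerCocycle n).hom := by
  obtain ⟨n, rfl⟩ := Nat.exists_eq_succ_of_ne_zero hn
  rw [← LinearMap.range_eq_top]
  by_contra hne
  obtain ⟨f, hf, hf0⟩ := Submodule.exists_le_ker_of_lt_top _ (lt_top_iff_ne_top.2 hne)
  let C := chains g.BaseGroup
  have hi : Function.Injective (C.iCycles (n + 1)).hom :=
    (ModuleCat.mono_iff_injective _).1 inferInstance
  have hπ : Function.Surjective (C.homologyπ (n + 1)).hom :=
    (ModuleCat.epi_iff_surjective _).1 inferInstance
  -- A linear retraction of chains onto cycles extends the functional to all chains, that is, to a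
  -- cochain.
  obtain ⟨r, hr⟩ := LinearMap.exists_leftInverse_of_injective _ (LinearMap.ker_eq_bot.2 hi)
  obtain ⟨β, hβ⟩ := exists_evalChains ((f ∘ₗ (C.homologyπ (n + 1)).hom) ∘ₗ r)
  have hβi (z) : evalChains β ((C.iCycles (n + 1)).hom z) = f ((C.homologyπ (n + 1)).hom z) := by
    rw [hβ]
    exact congrArg (fun z => f ((C.homologyπ (n + 1)).hom z)) (LinearMap.congr_fun hr z)
  have hβd : barD (n + 1) β = 0 := by
    apply evalChains_injective
    rw [← evalChains_comp_d]
    refine LinearMap.ext fun v => ?_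
    have h1 : ((C.d (n + 2) (n + 1))).hom v =
        (C.iCycles (n + 1)).hom ((C.toCycles (n + 2) (n + 1)).hom v) :=
      congrArg (fun φ => φ.hom v) (C.toCycles_i (n + 2) (n + 1)).symm
    have h2 : (C.homologyπ (n + 1)).hom ((C.toCycles (n + 2) (n + 1)).hom v) = 0 :=
      congrArg (fun φ => φ.hom v) (C.toCycles_comp_homologyπ (n + 2) (n + 1))
    rw [LinearMap.comp_apply, h1, hβi, h2, evalChains_zero]
    exact map_zero f
  -- The functional β ∘ cap vanishes on cycles, as f vanishes on the image of the cap product; hence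
  -- it factors through the boundary.
  obtain ⟨αl, hαl⟩ := exists_comp_eq_of_ker_le (C.d (n + 3) (n + 2)).hom
    (evalChains β ∘ₗ (capChains g.eulerCocycle (n + 1)).hom) (by
      intro v hv
      obtain ⟨z, rfl⟩ := exists_cycles_of_d_eq_zero v hv
      have h1 : (capChains g.eulerCocycle (n + 1)).hom ((C.iCycles (n + 3)).hom z) =
          (C.iCycles (n + 1)).hom ((capCycles g.eulerCocycle (n + 1)).hom z) :=
        congrArg (fun φ => φ.hom z) (show C.iCycles (n + 3) ≫ capChains g.eulerCocycle (n + 1) =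
          capCycles g.eulerCocycle (n + 1) ≫ C.iCycles (n + 1) from (C.liftCycles_i _ _ _ _).symm)
      have h2 : (C.homologyπ (n + 1)).hom ((capCycles g.eulerCocycle (n + 1)).hom z) =
          (capHomology g.eulerCocycle (n + 1)).hom ((C.homologyπ (n + 3)).hom z) :=
        congrArg (fun φ => φ.hom z) (π_capHomology g.eulerCocycle (n + 1)).symm
      rw [LinearMap.comp_apply, h1, hβi, h2]
      exact hf0 ⟨_, rfl⟩)
  obtain ⟨α, rfl⟩ := exists_evalChains αl
  rw [evalChains_comp_d, evalChains_comp_capChains] at hαl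
  obtain ⟨β', hβ'⟩ := g.exists_primitive n h α β hβd (evalChains_injective hαl)
  refine hf (LinearMap.ext fun w => ?_)
  obtain ⟨z, rfl⟩ := hπ w
  have h1 : (C.d (n + 1) n).hom ((C.iCycles (n + 1)).hom z) = 0 :=
    congrArg (fun φ => φ.hom z) (C.iCycles_d (n + 1) n)
  rw [← hβi, ← hβ', ← evalChains_comp_d, LinearMap.comp_apply, h1, map_zero]
  rfl

/-- A `(n+1)`-cocycle of a group with vanishing `H_{n+1}` is a coboundary. -/
theorem exists_barD_eq {n : ℕ} (h : Subsingleton (groupHomology (Rep.trivial ℚ G ℚ) (n + 1)))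
    (f : (Fin (n + 1) → G) → ℚ) (hf : barD (n + 1) f = 0) : ∃ f', barD n f' = f := by
  let C := chains G
  obtain ⟨ψ, hψ⟩ := exists_comp_eq_of_ker_le (C.d (n + 1) n).hom (evalChains f) (by
    intro v hv
    have hex : C.ExactAt (n + 1) := by
      rw [HomologicalComplex.exactAt_iff_isZero_homology]
      exact @ModuleCat.isZero_of_subsingleton _ _ _ h
    rw [HomologicalComplex.exactAt_iff' _ (n + 2) (n + 1) n (by simp) (by simp),
      ShortComplex.moduleCat_exact_iff] at hex
    obtain ⟨w, rfl⟩ := hex v hv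
    refine (LinearMap.congr_fun (evalChains_comp_d f) w).trans ?_
    rw [hf]
    exact evalChains_zero w)
  obtain ⟨f', rfl⟩ := exists_evalChains ψ
  exact ⟨f', evalChains_injective ((evalChains_comp_d f').symm.trans hψ)⟩

/-- Along surjections, the zeroth component of the inverse limit is arbitrary. -/
theorem subsingleton_groupHomology_of_capLimit {Γ : Type} [Group Γ] (g : CentralElement Γ) (n : ℕ)
    (hs : ∀ k, Function.Surjective (capHomology g.eulerCocycle (n + 2 * k)).hom)
    (hlim : g.capLimit n = ⊥) :
    Subsingleton (groupHomology (Rep.trivial ℚ g.BaseGroup ℚ) n) := by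
  refine subsingleton_of_forall_eq 0 fun z₀ => ?_
  choose r hr using hs
  let z (k : ℕ) : groupHomology (Rep.trivial ℚ g.BaseGroup ℚ) (n + 2 * k) :=
    Nat.rec (motive := fun k => groupHomology (Rep.trivial ℚ g.BaseGroup ℚ) (n + 2 * k)) z₀
      (fun k w => r k w) k
  have hz : z ∈ g.capLimit n := fun k => hr k (z k)
  rw [hlim, Submodule.mem_bot] at hz
  exact congrFun hz 0

theorem cohomologyPower_eq_zero (c : TwoCocycle G) (m : ℕ)
    (h : Subsingleton (groupHomology (Rep.trivial ℚ G ℚ) (2 * (m + 1)))) :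
    cohomologyPower c (m + 1) = 0 := by
  obtain ⟨f, hf⟩ := exists_barD_eq (n := 2 * m + 1) h (cupPower c (m + 1)) (d_cupPower c (m + 1))
  let C := groupCohomology.inhomogeneousCochains (Rep.trivial ℚ G ℚ)
  have h1 : groupCohomology.cocyclesMk (cupPower c (m + 1)) (d_cupPower c (m + 1)) =
      (C.toCycles (2 * m + 1) (2 * (m + 1))).hom f := by
    have hi : Function.Injective (C.iCycles (2 * (m + 1))).hom :=
      (ModuleCat.mono_iff_injective _).1 inferInstance
    apply hi
    refine (groupCohomology.iCocycles_mk _ _).trans ?_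
    have h2 : (C.d (2 * m + 1) (2 * (m + 1))).hom f =
        (C.iCycles (2 * (m + 1))).hom ((C.toCycles (2 * m + 1) (2 * (m + 1))).hom f) :=
      congrArg (fun φ => φ.hom f) (C.toCycles_i (2 * m + 1) (2 * (m + 1))).symm
    rw [← h2, ← hf]
    exact (congrArg (fun φ => φ.hom f) (groupCohomology.inhomogeneousCochains.d_def
      (Rep.trivial ℚ G ℚ) (2 * m + 1))).symm
  rw [cohomologyPower, h1]
  exact congrArg (fun φ => φ.hom f) (C.toCycles_comp_homologyπ (2 * m + 1) (2 * (m + 1)))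

/-- The Euler class of a central extension is nilpotent. -/
theorem exists_cohomologyPower_eq_zero {Γ : Type} [Group Γ] (hCBP : CBP Γ)
    (hcd : HasFiniteRationalCD Γ) (g : CentralElement Γ) :
    ∃ m : ℕ, cohomologyPower g.eulerCocycle (m + 1) = 0 := by
  obtain ⟨d, hd⟩ := hcd
  -- The power d + 1 lies in degree 2(d + 1), and all degrees 2(d + 1) + 2k + 1 needed for
  -- surjectivity along the tower exceed d.
  refine ⟨d, cohomologyPower_eq_zero _ _ ?_⟩
  refine subsingleton_groupHomology_of_capLimit g _ (fun k => ?_) (hCBP g _)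
  exact capHomology_surjective g _ (by omega) (hd _ _ (by omega))

end

open Opposite
open scoped Simplicial

/-! ### Powers of the fundamental class of K(ℤ, 2) -/

section Delooping

/-- The last `k + 1` vertices of the standard simplex. -/
def lastVertices (n k : ℕ) : ⦋k⦌ ⟶ ⦋n + k⦌ :=
  SimplexCategory.mkHom ⟨fun i => Fin.natAdd n i, fun _ _ h => Fin.natAdd_le_natAdd_iff n |>.2 h⟩

/-- The value of a simplex of `K(ℤ, 2)` on its last triangle. -/
def lastTriangle {n : ℕ} (z : deloopingTwo _⦋n + 2⦌) : ℚ := (z.1 (lastVertices n 2) : ℚ)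

/-- The front face of a simplex that omits the last two vertices. -/
def frontFace {n : ℕ} (z : deloopingTwo _⦋n + 2⦌) : deloopingTwo _⦋n⦌ :=
  deloopingTwo.δ (Fin.last (n + 1)) (deloopingTwo.δ (Fin.last (n + 2)) z)

theorem lastVertices_δ_castSucc (n : ℕ) (j : Fin (n + 1)) :
    lastVertices n 2 ≫ SimplexCategory.δ j.castSucc.castSucc.castSucc =
      SimplexCategory.δ 0 ≫ lastVertices n 3 := by
  ext i : 3
  apply Fin.ext
  change ((j.castSucc.castSucc.castSucc.succAbove (Fin.natAdd n i) : Fin (n + 4)) : ℕ) =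
    ((Fin.natAdd n (Fin.succAbove 0 i) : Fin (n + 4)) : ℕ)
  have := j.2
  simp only [Fin.succAbove, Fin.lt_def, Fin.val_castSucc, Fin.val_natAdd, Fin.val_zero]
  split_ifs <;> simp <;> omega

theorem lastVertices_δ_natAdd (n : ℕ) (k : Fin 4) :
    lastVertices n 2 ≫ SimplexCategory.δ (Fin.natAdd n k) =
      SimplexCategory.δ k ≫ lastVertices n 3 := by
  ext i : 3
  apply Fin.ext
  change (((Fin.natAdd n k).succAbove (Fin.natAdd n i) : Fin (n + 4)) : ℕ) =
    ((Fin.natAdd n (Fin.succAbove k i) : Fin (n + 4)) : ℕ)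
  simp only [Fin.succAbove, Fin.lt_def, Fin.val_castSucc, Fin.val_natAdd]
  split_ifs <;> simp <;> omega

theorem lastVertices_succ (n : ℕ) :
    lastVertices (n + 1) 2 = SimplexCategory.δ 0 ≫ lastVertices n 3 := by
  ext i : 3
  apply Fin.ext
  change ((Fin.natAdd (n + 1) i : Fin (n + 1 + 3)) : ℕ) =
    ((Fin.natAdd n (Fin.succAbove 0 i) : Fin (n + 4)) : ℕ)
  simp only [Fin.zero_succAbove, Fin.val_natAdd, Fin.val_succ]
  omega

theorem lastTriangle_δ_castSucc {n : ℕ} (y : deloopingTwo _⦋n + 3⦌) (j : Fin (n + 1)) :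
    lastTriangle (deloopingTwo.δ j.castSucc.castSucc.castSucc y) = lastTriangle (n := n + 1) y := by
  change ((y.1 (lastVertices n 2 ≫ SimplexCategory.δ j.castSucc.castSucc.castSucc) : ℤ) : ℚ) =
    (y.1 (lastVertices (n + 1) 2) : ℤ)
  rw [lastVertices_δ_castSucc, lastVertices_succ]

theorem lastTriangle_δ_natAdd {n : ℕ} (y : deloopingTwo _⦋n + 3⦌) (k : Fin 4) :
    lastTriangle (deloopingTwo.δ (n := n + 2) (Fin.natAdd n k) y) =
      (y.1 (SimplexCategory.δ k ≫ lastVertices n 3) : ℤ) := by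
  change ((y.1 (lastVertices n 2 ≫ SimplexCategory.δ (Fin.natAdd n k)) : ℤ) : ℚ) = _
  rw [lastVertices_δ_natAdd]

/-- This is the cocycle condition of y on the tetrahedron spanned by its last four vertices. -/
theorem lastTriangle_cocycle {n : ℕ} (y : deloopingTwo _⦋n + 3⦌) :
    lastTriangle (n := n + 1) y =
      lastTriangle (deloopingTwo.δ (Fin.last (n + 1)).castSucc.castSucc y) -
        lastTriangle (deloopingTwo.δ (Fin.last (n + 2)).castSucc y) +
        lastTriangle (deloopingTwo.δ (Fin.last (n + 3)) y) := by
  have h := y.2.1 (lastVertices n 3)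
  rw [Fin.sum_univ_four] at h
  have h0 : lastTriangle (n := n + 1) y = (y.1 (SimplexCategory.δ 0 ≫ lastVertices n 3) : ℤ) := by
    rw [← lastVertices_succ]
    rfl
  rw [h0, show (Fin.last (n + 1)).castSucc.castSucc = Fin.natAdd n (1 : Fin 4) from rfl,
    show (Fin.last (n + 2)).castSucc = Fin.natAdd n (2 : Fin 4) from rfl,
    show Fin.last (n + 3) = Fin.natAdd n (3 : Fin 4) from rfl, lastTriangle_δ_natAdd,
    lastTriangle_δ_natAdd, lastTriangle_δ_natAdd]
  have h' := congrArg (Int.cast : ℤ → ℚ) h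
  push_cast at h'
  norm_num at h'
  linarith

theorem frontFace_δ_castSucc {n : ℕ} (y : deloopingTwo _⦋n + 3⦌) (j : Fin (n + 2)) :
    frontFace (deloopingTwo.δ j.castSucc.castSucc y) = deloopingTwo.δ j (frontFace (n := n + 1) y) := by
  have h {k : ℕ} (i : Fin (k + 2)) (z : deloopingTwo _⦋k + 2⦌) :
      deloopingTwo.δ (Fin.last (k + 1)) (deloopingTwo.δ i.castSucc z) =
        deloopingTwo.δ i (deloopingTwo.δ (Fin.last (k + 2)) z) :=
    (congrArg (fun φ => φ z) (deloopingTwo.δ_comp_δ (Fin.le_last i))).symm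
  unfold frontFace
  rw [h, h]

theorem frontFace_δ_last {n : ℕ} (y : deloopingTwo _⦋n + 3⦌) :
    frontFace (deloopingTwo.δ (Fin.last (n + 3)) y) =
      deloopingTwo.δ (Fin.last (n + 1)) (frontFace (n := n + 1) y) := rfl

theorem frontFace_δ_penultimate {n : ℕ} (y : deloopingTwo _⦋n + 3⦌) :
    frontFace (deloopingTwo.δ (Fin.last (n + 2)).castSucc y) =
      deloopingTwo.δ (Fin.last (n + 1)) (frontFace (n := n + 1) y) := by
  have h : deloopingTwo.δ (Fin.last (n + 2)) (deloopingTwo.δ (Fin.last (n + 2)).castSucc y) =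
        deloopingTwo.δ (Fin.last (n + 2)) (deloopingTwo.δ (Fin.last (n + 3)) y) :=
    (congrArg (fun φ => φ y) (deloopingTwo.δ_comp_δ (Fin.le_last (Fin.last (n + 2))))).symm
  unfold frontFace
  rw [h]

/-- The cup product with the fundamental cocycle commutes with the coboundary. -/
theorem sum_frontFace_mul_lastTriangle {n : ℕ} (f : deloopingTwo _⦋n⦌ → ℚ)
    (y : deloopingTwo _⦋n + 3⦌) :
    ∑ i : Fin (n + 4), (-1 : ℚ) ^ (i : ℕ) *
        (f (frontFace (deloopingTwo.δ i y)) * lastTriangle (deloopingTwo.δ i y)) =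
      (∑ i : Fin (n + 2), (-1 : ℚ) ^ (i : ℕ) * f (deloopingTwo.δ i (frontFace (n := n + 1) y))) *
        lastTriangle (n := n + 1) y := by
  -- The faces n + 1, n + 2 and n + 3 have the same front face, so `lastTriangle_cocycle` merges
  -- them into the last summand on the right; the earlier faces leave the last triangle unchanged
  -- and match term by term.
  rw [Fin.sum_univ_castSucc, Fin.sum_univ_castSucc, Fin.sum_univ_castSucc,
    Fin.sum_univ_castSucc (n := n + 1), add_mul, Finset.sum_mul]
  simp only [frontFace_δ_castSucc, frontFace_δ_last, frontFace_δ_penultimate,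
    lastTriangle_δ_castSucc, Fin.val_castSucc, Fin.val_last]
  rw [lastTriangle_cocycle y, add_assoc, add_assoc]
  congr 1
  · exact Finset.sum_congr rfl fun j _ => by ring
  · ring

/-- The powers of the fundamental cocycle of `K(ℤ, 2)`. -/
def universalPower (m : ℕ) : deloopingTwo _⦋2 * m⦌ → ℚ :=
  Nat.rec (motive := fun m => deloopingTwo _⦋2 * m⦌ → ℚ) (fun _ => 1)
    (fun m f (z : deloopingTwo _⦋2 * m + 2⦌) => f (frontFace z) * lastTriangle z) m

theorem sum_universalPower_δ (m : ℕ) (y : deloopingTwo _⦋2 * m + 1⦌) :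
    ∑ i : Fin (2 * m + 2), (-1 : ℚ) ^ (i : ℕ) * universalPower m (deloopingTwo.δ i y) = 0 := by
  induction m with
  | zero =>
    change ∑ i : Fin 2, (-1 : ℚ) ^ (i : ℕ) * 1 = 0
    simp
  | succ m ih =>
    refine (sum_frontFace_mul_lastTriangle (universalPower m) y).trans ?_
    rw [ih, zero_mul]

theorem d_universalPower (m : ℕ) :
    ((simplicialCochains deloopingTwo).d (2 * m) (2 * m + 1)).hom (universalPower m) = 0 :=
  funext fun y => (simplicialCochains_d_apply deloopingTwo (2 * m) (universalPower m) y).trans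
    (sum_universalPower_δ m y)

/-- The powers of the fundamental class of `K(ℤ, 2)`. -/
def universalClass (m : ℕ) : (simplicialCochains deloopingTwo).homology (2 * m) :=
  ((simplicialCochains deloopingTwo).homologyπ (2 * m)).hom
    ((simplicialCochains deloopingTwo).cyclesMk (universalPower m) (2 * m + 1) (by simp)
      (d_universalPower m))

variable {G : Type} [Group G] (c : TwoCocycle G)

theorem δ_last_classifyingSimplex {n : ℕ} (x : Fin (n + 1) → G) :
    deloopingTwo.δ (Fin.last (n + 1)) (classifyingSimplex c x) =
      classifyingSimplex c (Fin.init x) := by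
  rw [← Fin.succ_last, δ_succ_classifyingSimplex]
  congr 1
  funext i
  simp [Fin.init, Fin.contractNth]

theorem edge_castSucc_succ {n : ℕ} (x : Fin n → G) (i : Fin n) :
    edge x i.castSucc i.succ = x i := by
  simp [edge, Fin.partialProd_succ]

/-- The comparison is strict on cochains: the front face forgets the last two entries of x, and
these entries are the two consecutive edges of the last triangle. -/
theorem universalPower_classifyingSimplex (m : ℕ) (x : Fin (2 * m) → G) :
    universalPower m (classifyingSimplex c x) = cupPower c m x := by
  induction m with
  | zero => rfl
  | succ m ih =>
    change Fin (2 * m + 2) → G at x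
    change universalPower m (frontFace (classifyingSimplex c x)) *
      lastTriangle (classifyingSimplex c x) = cupPower c m (fun i => x (Fin.castAdd 2 i)) *
        c.toCochain (fun i => x (Fin.natAdd (2 * m) i))
    have h1 : frontFace (classifyingSimplex c x) =
        classifyingSimplex c (fun i => x (Fin.castAdd 2 i)) := by
      unfold frontFace
      rw [δ_last_classifyingSimplex, δ_last_classifyingSimplex]
      rfl
    have h2 : lastTriangle (classifyingSimplex c x) =
        c.toCochain (fun i => x (Fin.natAdd (2 * m) i)) := by
      have e1 := edge_castSucc_succ x (Fin.natAdd (2 * m) (0 : Fin 2))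
      have e2 := edge_castSucc_succ x (Fin.natAdd (2 * m) (1 : Fin 2))
      exact congrArg₂ (fun a b => (c.toFun a b : ℚ)) e1 e2
    rw [h1, ih, h2]

theorem classifyingMap_universalClass (m : ℕ) :
    (classifyingMap c (2 * m)).hom (universalClass m) = cohomologyPower c m := by
  let C := groupCohomology.inhomogeneousCochains (Rep.trivial ℚ G ℚ)
  let K := simplicialCochains deloopingTwo
  let z := K.cyclesMk (universalPower m) (2 * m + 1) (by simp) (d_universalPower m)
  have h1 : (HomologicalComplex.homologyMap (classifyingCochains c) (2 * m)).hom
      ((K.homologyπ (2 * m)).hom z) = (C.homologyπ (2 * m)).hom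
        ((HomologicalComplex.cyclesMap (classifyingCochains c) (2 * m)).hom z) :=
    congrArg (fun φ => φ.hom z)
      (HomologicalComplex.homologyπ_naturality (classifyingCochains c) (2 * m))
  refine h1.trans (congrArg (C.homologyπ (2 * m)).hom ?_)
  have hi : Function.Injective (C.iCycles (2 * m)).hom :=
    (ModuleCat.mono_iff_injective _).1 inferInstance
  apply hi
  refine Eq.trans ?_ (groupCohomology.iCocycles_mk _ _).symm
  have h2 : (C.iCycles (2 * m)).hom
      ((HomologicalComplex.cyclesMap (classifyingCochains c) (2 * m)).hom z) =
      ((classifyingCochains c).f (2 * m)).hom ((K.iCycles (2 * m)).hom z) :=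
    congrArg (fun φ => φ.hom z)
      (HomologicalComplex.cyclesMap_i (classifyingCochains c) (2 * m))
  rw [h2]
  have h3 : (K.iCycles (2 * m)).hom z = universalPower m := K.i_cyclesMk _ _ _ _
  rw [h3]
  exact funext (universalPower_classifyingSimplex c m)

end Delooping

/-! ### Antisymmetrised simplices of abelian groups -/

section Antisymmetrization

variable {G : Type} [CommGroup G]

theorem sum_sign_mul_eq_zero {n : ℕ} (F : Equiv.Perm (Fin n) → ℚ) (τ : Equiv.Perm (Fin n))
    (hτ : Equiv.Perm.sign τ = -1) (hF : ∀ σ, F (σ * τ) = F σ) :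
    ∑ σ : Equiv.Perm (Fin n), ((Equiv.Perm.sign σ : ℤ) : ℚ) * F σ = 0 := by
  have h := Equiv.sum_comp (Equiv.mulRight τ)
    (fun σ : Equiv.Perm (Fin n) => ((Equiv.Perm.sign σ : ℤ) : ℚ) * F σ)
  simp only [Equiv.coe_mulRight, hF, Equiv.Perm.sign_mul, hτ] at h
  simp only [Units.val_neg, mul_neg, mul_one, Int.cast_neg, neg_mul,
    Finset.sum_neg_distrib] at h
  linarith

theorem contractNth_swap {n : ℕ} (j : Fin n) (x : Fin (n + 1) → G) :
    Fin.contractNth j.castSucc (· * ·) (x ∘ Equiv.swap j.castSucc j.succ) =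
      Fin.contractNth j.castSucc (· * ·) x := by
  funext k
  have hj := j.2
  rcases lt_trichotomy (k : ℕ) (j : ℕ) with h | h | h
  · rw [Fin.contractNth_apply_of_lt _ _ _ _ (by simpa using h),
      Fin.contractNth_apply_of_lt _ _ _ _ (by simpa using h), Function.comp_apply,
      Equiv.swap_apply_of_ne_of_ne]
    · simp only [ne_eq, Fin.ext_iff, Fin.val_castSucc]; omega
    · simp only [ne_eq, Fin.ext_iff, Fin.val_castSucc, Fin.val_succ]; omega
  · obtain rfl : k = j := Fin.ext h
    rw [Fin.contractNth_apply_of_eq _ _ _ _ (by simp), Fin.contractNth_apply_of_eq _ _ _ _ (by simp)]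
    simp [mul_comm]
  · rw [Fin.contractNth_apply_of_gt _ _ _ _ (by simpa using h),
      Fin.contractNth_apply_of_gt _ _ _ _ (by simpa using h), Function.comp_apply,
      Equiv.swap_apply_of_ne_of_ne]
    · simp only [ne_eq, Fin.ext_iff, Fin.val_castSucc, Fin.val_succ]; omega
    · simp only [ne_eq, Fin.ext_iff, Fin.val_succ]; omega

/-- Coboundaries vanish on the antisymmetrisation of a simplex of an abelian group. -/
theorem sum_sign_mul_barD {n : ℕ} (f : (Fin n → G) → ℚ) (a : Fin (n + 1) → G) :
    ∑ σ : Equiv.Perm (Fin (n + 1)), ((Equiv.Perm.sign σ : ℤ) : ℚ) * barD n f (a ∘ σ) = 0 := by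
  have hlast (x : Fin (n + 1) → G) : Fin.contractNth (Fin.last n) (· * ·) x = Fin.init x := by
    funext i
    simp [Fin.init, Fin.contractNth]
  have h1 (j : Fin n) : ∑ σ : Equiv.Perm (Fin (n + 1)), ((Equiv.Perm.sign σ : ℤ) : ℚ) *
      f (Fin.contractNth j.castSucc (· * ·) (a ∘ σ)) = 0 := by
    -- An inner face multiplies two neighbours; by commutativity it does not see their exchange,
    -- which reverses the sign.
    refine sum_sign_mul_eq_zero _ (Equiv.swap j.castSucc j.succ)
      (Equiv.Perm.sign_swap (Fin.castSucc_lt_succ).ne) fun σ => ?_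
    rw [Equiv.Perm.coe_mul, ← Function.comp_assoc, contractNth_swap]
  have h2 : ∑ σ : Equiv.Perm (Fin (n + 1)), ((Equiv.Perm.sign σ : ℤ) : ℚ) * f (Fin.init (a ∘ σ)) =
      (-1 : ℚ) ^ n * ∑ σ : Equiv.Perm (Fin (n + 1)), ((Equiv.Perm.sign σ : ℤ) : ℚ) *
        f (fun i => (a ∘ σ) i.succ) := by
    -- A cyclic rotation, of sign (-1)^n, turns the last outer face into the first; with the bar
    -- sign (-1)^{n+1} the two cancel.
    rw [← Equiv.sum_comp (Equiv.mulRight (finRotate (n + 1))), Finset.mul_sum]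
    refine Finset.sum_congr rfl fun σ _ => ?_
    have h3 : Fin.init (a ∘ (σ * finRotate (n + 1))) = fun i => (a ∘ σ) i.succ := by
      funext i
      simp [Fin.init, Function.comp_apply]
    rw [Equiv.coe_mulRight, h3, Equiv.Perm.sign_mul, sign_finRotate]
    push_cast
    ring
  simp only [barD, Fin.sum_univ_castSucc, mul_add, Finset.sum_add_distrib, smul_eq_mul,
    Finset.mul_sum, Fin.val_castSucc, Fin.val_last, hlast]
  rw [Finset.sum_comm]
  have h4 (j : Fin n) : ∑ σ : Equiv.Perm (Fin (n + 1)), ((Equiv.Perm.sign σ : ℤ) : ℚ) *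
      ((-1 : ℚ) ^ ((j : ℕ) + 1) * f (Fin.contractNth j.castSucc (· * ·) (a ∘ σ))) = 0 := by
    simp only [mul_left_comm _ ((-1 : ℚ) ^ ((j : ℕ) + 1))]
    rw [← Finset.mul_sum, h1, mul_zero]
  rw [Finset.sum_eq_zero fun j _ => h4 j]
  simp only [mul_left_comm _ ((-1 : ℚ) ^ (n + 1))]
  rw [← Finset.mul_sum, h2, ← mul_assoc, ← pow_add]
  have : (-1 : ℚ) ^ (n + 1 + n) = -1 := Odd.neg_one_pow ⟨n, by ring⟩
  rw [this]
  ring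

end Antisymmetrization

/-! ### Detecting powers of the fundamental class on tori -/

section Torus

variable {m : ℕ}

theorem exists_barD_eq_of_cohomologyPower_eq_zero {G : Type} [Group G] (c : TwoCocycle G)
    (h : cohomologyPower c (m + 1) = 0) :
    ∃ f : (Fin (2 * m + 1) → G) → ℚ, barD (2 * m + 1) f = cupPower c (m + 1) := by
  let C := groupCohomology.inhomogeneousCochains (Rep.trivial ℚ G ℚ)
  have hex := ShortComplex.exact_of_g_is_cokernel
    (ShortComplex.mk _ _ (C.toCycles_comp_homologyπ (2 * m + 1) (2 * (m + 1))))
    (C.homologyIsCokernel (2 * m + 1) (2 * (m + 1)) (CochainComplex.prev_nat_succ _))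
  rw [ShortComplex.moduleCat_exact_iff] at hex
  obtain ⟨f, hf⟩ := hex _ h
  refine ⟨f, ?_⟩
  have h1 : (C.d (2 * m + 1) (2 * (m + 1))).hom f =
      (C.iCycles (2 * (m + 1))).hom ((C.toCycles (2 * m + 1) (2 * (m + 1))).hom f) :=
    congrArg (fun φ => φ.hom f) (C.toCycles_i (2 * m + 1) (2 * (m + 1))).symm
  have h2 : (C.d (2 * m + 1) (2 * (m + 1))).hom f = barD (2 * m + 1) f :=
    congrArg (fun φ => φ.hom f) (groupCohomology.inhomogeneousCochains.d_def
      (Rep.trivial ℚ G ℚ) (2 * m + 1))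
  rw [← h2, h1]
  exact (congrArg (C.iCycles (2 * (m + 1))).hom hf).trans (groupCohomology.iCocycles_mk _ _)

/-- The even element `2i` of `Fin (2 * m)`. -/
def evenIndex (i : Fin m) : Fin (2 * m) := ⟨2 * i, by omega⟩

/-- The odd element `2i + 1` of `Fin (2 * m)`. -/
def oddIndex (i : Fin m) : Fin (2 * m) := ⟨2 * i + 1, by omega⟩

theorem cupPower_eq_prod {G : Type} [Group G] (c : TwoCocycle G) (x : Fin (2 * m) → G) :
    cupPower c m x = ∏ i : Fin m, (c.toFun (x (evenIndex i)) (x (oddIndex i)) : ℚ) := by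
  induction m with
  | zero => rfl
  | succ m ih =>
    rw [Fin.prod_univ_castSucc]
    exact congrArg (· * _) (ih fun i => x (Fin.castAdd 2 i))

/-- The cocycle `∑ xᵢ yᵢ₊₁`, over the even `i`, of a free abelian group of rank `2m`. -/
def torusCocycle (m : ℕ) : TwoCocycle (Multiplicative (Fin (2 * m) → ℤ)) where
  toFun x y := ∑ i : Fin m, x.toAdd (evenIndex i) * y.toAdd (oddIndex i)
  cocycle x y z := by
    simp only [toAdd_mul, Pi.add_apply, add_mul, mul_add, Finset.sum_add_distrib]
    ring
  one_left x := by simp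
  one_right x := by simp

theorem torusCocycle_toFun (x y : Multiplicative (Fin (2 * m) → ℤ)) : (torusCocycle m).toFun x y =
    ∑ i : Fin m, x.toAdd (evenIndex i) * y.toAdd (oddIndex i) := rfl

/-- The standard generators. -/
def torusGenerator (j : Fin (2 * m)) : Multiplicative (Fin (2 * m) → ℤ) :=
  Multiplicative.ofAdd (Pi.single j 1)

theorem torusCocycle_generator_nonneg (p q : Fin (2 * m)) :
    0 ≤ (torusCocycle m).toFun (torusGenerator p) (torusGenerator q) := by
  rw [torusCocycle_toFun]
  refine Finset.sum_nonneg fun i _ => mul_nonneg ?_ ?_ <;>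
  · simp only [torusGenerator, toAdd_ofAdd, Pi.single_apply]
    split_ifs <;> simp

theorem exists_of_torusCocycle_ne_zero {p q : Fin (2 * m)}
    (h : (torusCocycle m).toFun (torusGenerator p) (torusGenerator q) ≠ 0) :
    ∃ i, p = evenIndex i ∧ q = oddIndex i := by
  rw [torusCocycle_toFun] at h
  obtain ⟨i, -, hi⟩ := Finset.exists_ne_zero_of_sum_ne_zero h
  refine ⟨i, ?_⟩
  simp only [torusGenerator, toAdd_ofAdd, Pi.single_apply] at hi
  have h1 := left_ne_zero_of_mul hi
  have h2 := right_ne_zero_of_mul hi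
  rw [Ne, ite_eq_right_iff, Classical.not_imp] at h1 h2
  exact ⟨h1.1.symm, h2.1.symm⟩

theorem torusCocycle_even_odd (i : Fin m) :
    (torusCocycle m).toFun (torusGenerator (evenIndex i)) (torusGenerator (oddIndex i)) = 1 := by
  rw [torusCocycle_toFun, Finset.sum_eq_single i]
  · simp [torusGenerator]
  · intro j _ hj
    have : evenIndex j ≠ evenIndex i := fun h => hj (Fin.ext (by
      have := congrArg Fin.val h
      simp only [evenIndex] at this
      omega))
    simp [torusGenerator, this]
  · simp

/-- A permutation that permutes the pairs `(2i, 2i + 1)` is even. -/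
theorem sign_eq_one_of_pairs (σ : Equiv.Perm (Fin (2 * m)))
    (h : ∀ i, ∃ j, σ (evenIndex i) = evenIndex j ∧ σ (oddIndex i) = oddIndex j) :
    Equiv.Perm.sign σ = 1 := by
  choose t ht₀ ht₁ using h
  have ht : Function.Injective t := fun i j hij => by
    have h1 : evenIndex i = evenIndex j := σ.injective (by rw [ht₀, ht₀, hij])
    have := congrArg Fin.val h1
    simp only [evenIndex] at this
    exact Fin.ext (by omega)
  let τ : Equiv.Perm (Fin m) := Equiv.ofBijective t (Finite.injective_iff_bijective.1 ht)
  let e : Fin 2 × Fin m → Fin (2 * m) := fun p => if p.1 = 0 then evenIndex p.2 else oddIndex p.2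
  have he : Function.Bijective e := by
    rw [Fintype.bijective_iff_injective_and_card]
    refine ⟨?_, by simp⟩
    rintro ⟨p, i⟩ ⟨q, j⟩ h
    have h' := congrArg Fin.val h
    fin_cases p <;> fin_cases q <;> simp [e, evenIndex, oddIndex] at h' ⊢ <;> omega
  -- Under Fin 2 × Fin m ≃ Fin (2m), σ acts as τ on the even and on the odd indices, so its sign is
  -- sign(τ)² = 1.
  have hσ : σ = ((Equiv.ofBijective e he).symm.trans
      (Equiv.prodCongrRight fun _ : Fin 2 => τ)).trans (Equiv.ofBijective e he) := by
    ext1 k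
    obtain ⟨⟨p, i⟩, rfl⟩ := (Equiv.ofBijective e he).surjective k
    rw [Equiv.trans_apply, Equiv.trans_apply, Equiv.symm_apply_apply]
    fin_cases p
    · exact ht₀ i
    · exact ht₁ i
  rw [hσ, Equiv.Perm.sign_symm_trans_trans, Equiv.Perm.sign_prodCongrRight]
  simp

/-- A term is nonzero only if σ carries each pair (2i, 2i + 1) to such a pair; then σ is even and
the term is nonnegative. The identity contributes 1, so nothing cancels. -/
theorem torus_sum_pos (m : ℕ) : 0 < ∑ σ : Equiv.Perm (Fin (2 * m)),
    ((Equiv.Perm.sign σ : ℤ) : ℚ) * cupPower (torusCocycle m) m (torusGenerator ∘ σ) := by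
  refine Finset.sum_pos' (fun σ _ => ?_) ⟨1, Finset.mem_univ _, ?_⟩
  · rw [cupPower_eq_prod]
    by_cases h : ∀ i, (torusCocycle m).toFun ((torusGenerator ∘ σ) (evenIndex i))
        ((torusGenerator ∘ σ) (oddIndex i)) ≠ 0
    · rw [sign_eq_one_of_pairs σ fun i => exists_of_torusCocycle_ne_zero (h i)]
      simp only [Units.val_one, Int.cast_one, one_mul]
      exact Finset.prod_nonneg fun i _ => Int.cast_nonneg (torusCocycle_generator_nonneg _ _)
    · push Not at h
      obtain ⟨i, hi⟩ := h
      rw [Finset.prod_eq_zero (Finset.mem_univ i) (by exact_mod_cast hi), mul_zero]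
  · rw [cupPower_eq_prod]
    simp [torusCocycle_even_odd]

theorem cohomologyPower_torusCocycle_ne_zero (m : ℕ) :
    cohomologyPower (torusCocycle (m + 1)) (m + 1) ≠ 0 := by
  intro h
  obtain ⟨f, hf⟩ := exists_barD_eq_of_cohomologyPower_eq_zero _ h
  refine (torus_sum_pos (m + 1)).ne' ?_
  rw [← hf]
  exact sum_sign_mul_barD f (torusGenerator (m := m + 1))

/-- It suffices that one pullback is nonzero, and the torus of dimension 2(m + 1) provides it. -/
theorem universalClass_ne_zero (m : ℕ) : universalClass (m + 1) ≠ 0 := by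
  intro h
  apply cohomologyPower_torusCocycle_ne_zero m
  rw [← classifyingMap_universalClass, h]
  exact map_zero _

/-- If a positive power of the class of a cocycle vanishes, the classifying map is not injective on
cohomology. -/
theorem not_injective_classifyingMap {G : Type} [Group G] (c : TwoCocycle G)
    (h : cohomologyPower c (m + 1) = 0) :
    ¬ Function.Injective (classifyingMap c (2 * (m + 1))) := fun hinj =>
  universalClass_ne_zero m (hinj (((classifyingMap_universalClass c (m + 1)).trans h).trans
    (map_zero (classifyingMap c (2 * (m + 1))).hom).symm))

end Torus

end CentralBurghelea

end

theorem mainTheorem8 (Γ : Type) [Group Γ] (hCBP : CentralBurghelea.CBP Γ)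
    (hcd : CentralBurghelea.HasFiniteRationalCD Γ)
    (hft : CentralBurghelea.HasFiniteTypeRationalHomology Γ) :
    CentralBurghelea.IKP Γ ∧
      ∀ g : CentralBurghelea.CentralElement Γ, ∃ m : ℕ,
        CentralBurghelea.cohomologyPower g.eulerCocycle m = 0 := by
  have h := CentralBurghelea.exists_cohomologyPower_eq_zero hCBP hcd
  refine ⟨⟨hcd, fun g => ?_⟩, fun g => (h g).imp' Nat.succ fun _ hm => hm⟩
  obtain ⟨m, hm⟩ := h g
  exact ⟨_, CentralBurghelea.not_injective_classifyingMap _ hm⟩
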